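/- Let $M=(m_{ij})_{i,j\in I}$ be a Coxeter matrix on a finite set $I$ (symmetric, $m_{ii}=1$, $m_{ij}\in\{2,3,\dots\}\cup\{\infty\}$ for $i\ne j$). Let $W_I$ be its Coxeter group, with simple reflections $s_i$ and length function $\ell$, and let $A_I$ be its Artin-Tits group: it has generators $\sigma_i$ $(i\in I)$ and the braid relations $\sigma_i\sigma_j\sigma_i\cdots=\sigma_j\sigma_i\sigma_j\cdots$ ($m_{ij}$ factors on each side) for $i\neq j$ with $m_{ij}<\infty$. For $X\subseteq I$ put $S_X=\{s_i : i\in X\}$, let $W_X\le W_I$ be generated by $S_X$, and let $A_X\le A_I$ be generated by $\{\sigma_i : i\in X\}$. Let $\kappa_I:W_I\to A_I$ be the canonical set section: $\kappa_I(w)=\sigma_{i_1}\cdots\sigma_{i_k}$ for any reduced word $s_{i_1}\cdots s_{i_k}$ of $w$. An element of $W_I$ is called $(X,Y)$-reduced if it has minimal length in its double coset modulo $W_X$ on the left and $W_Y$ on the right. Let $X,Y\subseteq I$ and $w\in W_I$, and put $\omega=\kappa_I(w)$. Then $w$ can be written $w=w_1w_2w_2'$ with $w_1\in W_X$, $w_2$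 $(X,Y)$-reduced and $w_2'\in W_Y$. For every such decomposition, let $X_1\subseteq X$ and $Y_1\subseteq Y$ be the subsets given by $S_{X_1}=S_X\cap w_2S_Yw_2^{-1}=w_2S_{Y_1}w_2^{-1}$. Then in $W_I$ $$wW_Yw^{-1}\cap W_X=(ww_2'^{-1})\,W_{Y_1}\,(ww_2'^{-1})^{-1}=w_1W_{X_1}w_1^{-1},$$ and in $A_I$ $$\omega A_Y\omega^{-1}\cap A_X=\bigl(\omega\,\kappa_I(w_2')^{-1}\bigr)A_{Y_1}\bigl(\omega\,\kappa_I(w_2')^{-1}\bigr)^{-1}=\kappa_I(w_1)\,A_{X_1}\,\kappa_I(w_1)^{-1},$$ $$\omega^{-1}A_X\omega\cap A_Y=\kappa_I(w_2')^{-1}A_{Y_1}\,\kappa_I(w_2').$$ In particular $\omega A_Y\omega^{-1}\cap A_X$ is a parabolic subgroup of $A_I$, that is, a conjugate of some $A_Z$ with $Z\subseteq I$. -/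

import Mathlib

open scoped Pointwise

namespace ArtinTits

variable {I : Type*} (M : CoxeterMatrix I)

/-- The braid relator of `i` and `j`: the quotient of the two alternating words
`⋯ i j` and `⋯ j i` of length `M i j`. It is trivial if `i = j` (as `M i i = 1`) and if
`M i j = 0`, which encodes that there is no relation between `i` and `j`. -/
def braidRelator (i j : I) : FreeGroup I :=
  ((CoxeterSystem.braidWord M i j).map FreeGroup.of).prod *
    ((CoxeterSystem.braidWord M j i).map FreeGroup.of).prod⁻¹

/-- The set of all braid relators. -/
def braidRelators : Set (FreeGroup I) := Set.range (Function.uncurry (braidRelator M))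

/-- The Artin-Tits group of `M`: one generator for each `i`, subject to the braid relations. -/
abbrev ArtinGroup : Type _ := PresentedGroup (braidRelators M)

/-- The standard generator `σ i` of the Artin-Tits group. -/
def sigma (i : I) : ArtinGroup M := PresentedGroup.of i

/-- The standard parabolic subgroup `A_X`, generated by the `σ i` with `i ∈ X`. -/
def artinParabolic (X : Set I) : Subgroup (ArtinGroup M) := Subgroup.closure (sigma M '' X)

/-- A parabolic subgroup: a conjugate of a standard parabolic subgroup. -/
def IsParabolic (H : Subgroup (ArtinGroup M)) : Prop :=
  ∃ (g : ArtinGroup M) (Z : Set I), H = MulAut.conj g • artinParabolic M Z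

/-- The standard parabolic subgroup `W_X` of the Coxeter group, generated by the `s i`
with `i ∈ X`. -/
def coxeterParabolic (X : Set I) : Subgroup M.Group := Subgroup.closure (M.simple '' X)

/-- The length of an element of the Coxeter group with respect to the simple reflections. -/
noncomputable def len (w : M.Group) : ℕ := M.toCoxeterSystem.length w

/-- The canonical section `κ : W → A`: if `s i₁ ⋯ s iₖ` is a reduced word for `w`, then
`κ w = σ i₁ ⋯ σ iₖ`. Any two reduced words for `w` are related by braid relations only, so the
element does not depend on which reduced word is chosen. -/
noncomputable def kappa (w : M.Group) : ArtinGroup M :=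
  ((M.toCoxeterSystem.exists_isReduced w).choose.map (sigma M)).prod

/-- `w` is `(X, Y)`-reduced: it has minimal length in the double coset `W_X w W_Y`. -/
def IsDoubleReduced (X Y : Set I) (w : M.Group) : Prop :=
  ∀ x ∈ coxeterParabolic M X, ∀ y ∈ coxeterParabolic M Y, len M w ≤ len M (x * w * y)

/-- `w = w₁ w₂ w₂'` with `w₁ ∈ W_X`, with `w₂` being `(X, Y)`-reduced, and with `w₂' ∈ W_Y`. -/
structure IsDecomposition (X Y : Set I) (w w₁ w₂ w₂' : M.Group) : Prop where
  left_mem : w₁ ∈ coxeterParabolic M X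
  reduced : IsDoubleReduced M X Y w₂
  right_mem : w₂' ∈ coxeterParabolic M Y
  eq_mul : w = w₁ * w₂ * w₂'

/-- The set `X₁ ⊆ X` with `S_{X₁} = S_X ∩ v S_Y v⁻¹`. -/
def leftSubset (X Y : Set I) (v : M.Group) : Set I :=
  {i | i ∈ X ∧ ∃ j ∈ Y, M.simple i = v * M.simple j * v⁻¹}

/-- The set `Y₁ ⊆ Y` with `v S_{Y₁} v⁻¹ = S_X ∩ v S_Y v⁻¹`. -/
def rightSubset (X Y : Set I) (v : M.Group) : Set I :=
  {j | j ∈ Y ∧ ∃ i ∈ X, M.simple i = v * M.simple j * v⁻¹}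

end ArtinTits

/-! The core is the case of an `(X, Y)`-reduced element `v`. There the inclusion that needs proof
says: if `α ∈ A_Y` and `κ(v) α κ(v)⁻¹ ∈ A_X`, then `α ∈ A_{Y₁}`.

To detect this, `A_I` is made to act on `(W / W_Y) × A_I` (`cosetAction`). Let `r` be the minimal
representative of `c`. By Deodhar's lemma either `s_i r = r s_j` for some `j ∈ Y`, or `s_i r` is
again minimal. The generator `σ_i` sends `(c, a)` to `(c, σ_j a)` in the first case and to `(s_i c,
a)` in the second. This is not left multiplication by `σ_i`, since it forgets squares when `s_i r`
is shorter than `r`, but it respects the braid relations (`wordEmission_braidWord`). At the base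
coset, `A_Y` acts by left multiplication on the second component, and `κ(v)` carries `(1, a)` to
`(v, a)`.

The pairs `(c, a)` with `r ∈ W_X v` and `a ∈ A_{Y₁}` form an `A_X`-stable set
(`IsDoubleReduced.cosetAction_mem_iff`): if `r = x v` and `s_i r = r s_j` with `i ∈ X`, then `v s_j
v⁻¹ ∈ W_X`, and comparing lengths gives `j ∈ Y₁`. With `β = κ(v) α κ(v)⁻¹` in `A_X`, the element `β
κ(v) = κ(v) α` sends `(1, 1)` both to `β (v, 1)`, which lies in the stable set, and to `(v, α)`.
Hence `α ∈ A_{Y₁}`. The Coxeter statement follows by lifting through `κ` and projecting back.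

For general `w = w₁ v w₂'` the lengths need not add, so `κ` need not be multiplicative on the
product. Splitting off from `w₁` a right factor in `W_{X₁}` and moving it across `v` gives a
length-additive `w = a v b`. The discrepancies between `κ(w₁)` and `κ(a)`, and between `κ(w₂')` and
`κ(b)`, lie in `A_{X₁}` and `A_{Y₁}`, and do not affect the conjugates
(`IsDecomposition.exists_kappa_eq`).

The Coxeter background consists of the exact orders of `s_i s_j`, the exchange condition, minimal
coset representatives and Matsumoto's theorem. -/

namespace CoxeterMatrix

/-! ### The geometric representation and the orders of products of two reflections. -/

variable {I : Type*} (M : CoxeterMatrix I)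

/-- The linear form `x ↦ 2 B(eᵢ, x)` of the geometric representation, where
`B(eᵢ, eⱼ) = -cos (π / M i j)`. The convention `π / 0 = 0` yields `-1` when `M i j = ∞`. -/
noncomputable def rootForm (i : I) : Module.Dual ℝ (I →₀ ℝ) :=
  Finsupp.lsum ℝ fun j => (-2 * Real.cos (Real.pi / M i j)) • LinearMap.id

theorem rootForm_single (i j : I) :
    M.rootForm i (Finsupp.single j 1) = -2 * Real.cos (Real.pi / M i j) := by
  simp [rootForm]

theorem rootForm_self (i : I) : M.rootForm i (Finsupp.single i 1) = 2 := by
  simp [rootForm_single]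

/-- The reflection in the simple root `eᵢ`. -/
noncomputable def rootReflection (i : I) : (I →₀ ℝ) ≃ₗ[ℝ] (I →₀ ℝ) :=
  Module.reflection (M.rootForm_self i)

theorem rootForm_mul_rootForm_sub_two (i j : I) :
    M.rootForm i (Finsupp.single j 1) * M.rootForm j (Finsupp.single i 1) - 2 =
      2 * Real.cos (2 * (Real.pi / M i j)) := by
  rw [rootForm_single, rootForm_single, M.symmetric j i, Real.cos_two_mul]
  ring

theorem S_eval_two_mul_cos_mul_sin (θ : ℝ) (n : ℤ) :
    (Polynomial.Chebyshev.S ℝ n).eval (2 * Real.cos θ) * Real.sin θ = Real.sin ((n + 1) * θ) :=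
  Polynomial.Chebyshev.S_two_mul_real_cos θ n

theorem sin_two_pi_div_pos {m : ℕ} (hm : 3 ≤ m) : 0 < Real.sin (2 * (Real.pi / m)) := by
  have h3 : (3 : ℝ) ≤ m := by exact_mod_cast hm
  have hp := Real.pi_pos
  apply Real.sin_pos_of_pos_of_lt_pi
  · positivity
  · rw [← mul_div_assoc, div_lt_iff₀ (by linarith)]
    nlinarith

theorem cos_pi_div_pos {m : ℕ} (hm : 3 ≤ m) : 0 < Real.cos (Real.pi / m) := by
  have h3 : (3 : ℝ) ≤ m := by exact_mod_cast hm
  have hp := Real.pi_pos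
  apply Real.cos_pos_of_mem_Ioo
  constructor
  · have : 0 < Real.pi / m := by positivity
    linarith
  · rw [div_lt_div_iff₀ (by linarith) (by norm_num)]
    nlinarith

theorem rootReflection_apply_of_two {i j : I} (h : M i j = 2) :
    M.rootReflection i (Finsupp.single j 1) = Finsupp.single j 1 := by
  rw [rootReflection, Module.reflection_apply, rootForm_single, h]
  simp

theorem two_le_of_ne {i j : I} (hij : i ≠ j) (h0 : M i j ≠ 0) : 2 ≤ M i j := by
  have := M.off_diagonal i j hij
  omega

theorem rootReflection_mul_pow (i j : I) :
    (M.rootReflection i * M.rootReflection j) ^ M i j = 1 := by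
  rcases eq_or_ne i j with rfl | hij
  · rw [M.diagonal, pow_one]
    exact mul_eq_one_iff_eq_inv.mpr (Module.reflection_inv _).symm
  rcases eq_or_ne (M i j) 0 with h0 | h0
  · rw [h0, pow_zero]
  have h2 := M.two_le_of_ne hij h0
  -- The value 2 is separate: there θ = π, and `sin θ = 0` cannot be cancelled from the Chebyshev
  -- identity.
  rcases h2.eq_or_lt with h2 | h3
  · have hji : M j i = 2 := by rw [M.symmetric j i, h2]
    rw [← h2]
    ext1 z
    have h1 : M.rootForm i (Finsupp.single j 1) = 0 := by simp [rootForm_single, ← h2]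
    have h1' : M.rootForm j (Finsupp.single i 1) = 0 := by simp [rootForm_single, hji]
    have hi := M.rootForm_self i
    have hj := M.rootForm_self j
    simp only [pow_two, LinearEquiv.mul_apply, rootReflection, Module.reflection_apply, map_sub,
      map_smul, h1, h1', hi, hj, LinearEquiv.coe_one, id]
    module
  · have hs := sin_two_pi_div_pos h3
    set θ := 2 * (Real.pi / M i j) with hθ
    have hmθ : (M i j : ℝ) * θ = 2 * Real.pi := by
      rw [hθ]; field_simp
    have key := S_eval_two_mul_cos_mul_sin θ
    ext1 z
    rw [rootReflection, rootReflection, Module.reflection_mul_reflection_pow_apply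
      (M.rootForm_self i) (M.rootForm_self j) (M i j) z (2 * Real.cos θ)
      (M.rootForm_mul_rootForm_sub_two i j).symm]
    have hS : ∀ k : ℤ, (2 * (k + 1) : ℝ) * θ = 2 * Real.pi →
        (Polynomial.Chebyshev.S ℝ k).eval (2 * Real.cos θ) = 0 := by
      intro k hk
      have := key k
      rw [show ((k : ℝ) + 1) * θ = Real.pi by linarith, Real.sin_pi] at this
      exact (mul_eq_zero.mp this).resolve_right hs.ne'
    have hS' : ∀ k : ℤ, (2 * k + 1 : ℝ) * θ = 2 * Real.pi →
        (Polynomial.Chebyshev.S ℝ k).eval (2 * Real.cos θ) +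
          (Polynomial.Chebyshev.S ℝ (k - 1)).eval (2 * Real.cos θ) = 0 := by
      intro k hk
      have h1 := key k
      have h2 := key (k - 1)
      push_cast at h2
      rw [show ((k : ℝ) + 1) * θ = 2 * Real.pi - (k - 1 + 1) * θ by linarith,
        Real.sin_two_pi_sub] at h1
      have : ((Polynomial.Chebyshev.S ℝ k).eval (2 * Real.cos θ) +
          (Polynomial.Chebyshev.S ℝ (k - 1)).eval (2 * Real.cos θ)) * Real.sin θ = 0 := by
        rw [add_mul, h1, h2]; ring
      exact (mul_eq_zero.mp this).resolve_right hs.ne'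
    rcases Nat.even_or_odd' (M i j) with ⟨k, hk | hk⟩
    · have e1 : ((M i j : ℤ) - 2) / 2 = k - 1 := by omega
      have e2 : ((M i j : ℤ) - 1) / 2 = k - 1 := by omega
      have := hS (k - 1) (by rw [← hmθ, hk]; push_cast; ring)
      rw [e1, e2, this]
      simp
    · have e1 : ((M i j : ℤ) - 1) / 2 = k := by omega
      have e2 : ((M i j : ℤ) - 3) / 2 = k - 1 := by omega
      have e3 : ((M i j : ℤ) - 2) / 2 = k - 1 := by omega
      have e4 : ((M i j : ℤ)) / 2 = k := by omega
      have := hS' k (by rw [← hmθ, hk]; push_cast; ring)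
      rw [e1, e2, e3, e4, this]
      simp

/-- The image of `eᵢ` under the power has Chebyshev values as coordinates. Comparing with `eᵢ` gives
`sin nθ = 0` and `cos nθ = 1` for θ = 2π/m when `3 ≤ m < ∞`, so `nθ` is a multiple of 2π. -/
theorem dvd_of_rootReflection_mul_pow_eq_one {i j : I} (hij : i ≠ j) {n : ℕ}
    (hn : (M.rootReflection i * M.rootReflection j) ^ n = 1) : M i j ∣ n := by
  have hx := congrArg (fun f : (I →₀ ℝ) ≃ₗ[ℝ] (I →₀ ℝ) => f (Finsupp.single i 1)) hn
  rcases eq_or_ne (M i j) 2 with h2 | h2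
  · have hji : M j i = 2 := by rw [M.symmetric j i, h2]
    have hpow : ∀ n : ℕ, ((M.rootReflection i * M.rootReflection j) ^ n) (Finsupp.single i 1) =
        ((-1 : ℝ) ^ n) • Finsupp.single i 1 := by
      intro n
      induction n with
      | zero => simp
      | succ n ih =>
        rw [pow_succ, LinearEquiv.mul_apply, LinearEquiv.mul_apply,
          M.rootReflection_apply_of_two hji]
        have : M.rootReflection i (Finsupp.single i 1) = -Finsupp.single i 1 :=
          Module.reflection_apply_self _
        rw [this, map_neg, ih, pow_succ]
        module
    rw [hpow] at hx
    have h1 := congrArg (fun f : I →₀ ℝ => f i) hx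
    simp only [Finsupp.smul_apply, Finsupp.single_eq_same, LinearEquiv.coe_one, id,
      smul_eq_mul, mul_one] at h1
    rw [h2]
    exact (neg_one_pow_eq_one_iff_even (by norm_num)).mp h1 |>.two_dvd
  set θ := 2 * (Real.pi / M i j) with hθ
  have hy : 1 = (Polynomial.Chebyshev.S ℝ n).eval (2 * Real.cos θ) +
        (Polynomial.Chebyshev.S ℝ (n - 1)).eval (2 * Real.cos θ) ∧
      0 = (Polynomial.Chebyshev.S ℝ (n - 1)).eval (2 * Real.cos θ) *
        -M.rootForm j (Finsupp.single i 1) := by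
    simp only [rootReflection] at hx
    rw [Module.reflection_mul_reflection_pow_apply_self
      (M.rootForm_self i) (M.rootForm_self j) n (2 * Real.cos θ)
      (M.rootForm_mul_rootForm_sub_two i j).symm] at hx
    have h1 := congrArg (fun f : I →₀ ℝ => f i) hx
    have h2 := congrArg (fun f : I →₀ ℝ => f j) hx
    simp only [Finsupp.add_apply, Finsupp.smul_apply, Finsupp.single_eq_same, LinearEquiv.coe_one,
      id, smul_eq_mul, Finsupp.single_eq_of_ne hij, Finsupp.single_eq_of_ne hij.symm, mul_one,
      mul_zero, add_zero, zero_add] at h1 h2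
    exact ⟨h1.symm, h2.symm⟩
  obtain ⟨hy1, hy2⟩ := hy
  rw [rootForm_single, M.symmetric j i] at hy2
  rcases eq_or_ne (M i j) 0 with h0 | h0
  -- For infinite order the convention `π / 0 = 0` makes θ = 0. The `eⱼ`-coordinate is then a
  -- nonzero multiple of `S_{n-1}(2) = n`, forcing `n = 0`.
  · have hθ0 : 2 * Real.cos θ = 2 := by simp [hθ, h0]
    rw [hθ0, h0, Polynomial.Chebyshev.S_eval_two] at hy2
    push_cast at hy2
    rw [div_zero, Real.cos_zero] at hy2
    have : (n : ℝ) = 0 := by linarith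
    rw [h0, zero_dvd_iff]
    exact_mod_cast this
  have h3 : 3 ≤ M i j := by
    have := M.two_le_of_ne hij h0
    omega
  have hc := cos_pi_div_pos h3
  have hs := sin_two_pi_div_pos h3
  have hS : (Polynomial.Chebyshev.S ℝ ((n : ℤ) - 1)).eval (2 * Real.cos θ) = 0 := by
    rcases mul_eq_zero.mp hy2.symm with h | h
    · exact h
    · linarith
  rw [hS, add_zero] at hy1
  have k1 := S_eval_two_mul_cos_mul_sin θ ((n : ℤ) - 1)
  have k2 := S_eval_two_mul_cos_mul_sin θ n
  rw [hS] at k1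
  rw [← hy1] at k2
  push_cast at k1 k2
  rw [show ((n : ℝ) - 1 + 1) * θ = n * θ by ring] at k1
  rw [show ((n : ℝ) + 1) * θ = n * θ + θ by ring, Real.sin_add, ← k1] at k2
  have hcos : Real.cos (n * θ) = 1 := by
    have : (Real.cos (n * θ) - 1) * Real.sin θ = 0 := by linarith
    linarith [(mul_eq_zero.mp this).resolve_right hs.ne']
  obtain ⟨l, hl⟩ := (Real.cos_eq_one_iff _).mp hcos
  have hm : (M i j : ℝ) ≠ 0 := by exact_mod_cast h0
  have hp := Real.pi_pos
  have : (n : ℝ) = M i j * l := by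
    have h5 : (M i j : ℝ) * (n * θ) = n * (2 * Real.pi) := by rw [hθ]; field_simp
    rw [← hl] at h5
    have : (2 * Real.pi) * ((M i j : ℝ) * l - n) = 0 := by linarith
    have := (mul_eq_zero.mp this).resolve_left (by positivity)
    linarith
  exact Int.natCast_dvd_natCast.mp ⟨l, by exact_mod_cast this⟩

end CoxeterMatrix

namespace CoxeterSystem

variable {I W : Type*} [Group W] {M : CoxeterMatrix I} (cs : CoxeterSystem M W)

/-- The products `s i * s j` have order exactly `M i j`, where `0` encodes infinite order. -/
theorem dvd_of_simple_mul_simple_pow_eq_one {i j : I} (hij : i ≠ j) {n : ℕ}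
    (hn : (cs.simple i * cs.simple j) ^ n = 1) : M i j ∣ n := by
  apply M.dvd_of_rootReflection_mul_pow_eq_one hij
  have h : M.IsLiftable M.rootReflection := M.rootReflection_mul_pow
  simpa using congrArg (cs.lift ⟨_, h⟩) hn

end CoxeterSystem

namespace CoxeterSystem

variable {I W : Type*} [Group W] {M : CoxeterMatrix I} (cs : CoxeterSystem M W)

/-! ### The exchange condition -/

theorem simple_injective : Function.Injective cs.simple := by
  intro i j h
  by_contra hij
  have := cs.dvd_of_simple_mul_simple_pow_eq_one hij (n := 1) (by rw [h]; simp)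
  exact M.off_diagonal i j hij (Nat.dvd_one.mp this)

open Classical in
/-- The action of a simple reflection on the set of signed group elements. -/
noncomputable def signedConj (i : I) : Equiv.Perm (W × ZMod 2) :=
  Function.Involutive.toPerm
    (fun p => (cs.simple i * p.1 * cs.simple i, p.2 + if p.1 = cs.simple i then 1 else 0)) <| by
    rintro ⟨t, ε⟩
    have h : cs.simple i * t * cs.simple i = cs.simple i ↔ t = cs.simple i := by
      constructor
      · intro h
        have := congrArg (fun x => cs.simple i * x * cs.simple i) h
        simpa [mul_assoc] using this
      · rintro rfl
        simp
    have h2 : (1 : ZMod 2) + 1 = 0 := by decide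
    ext
    · simp [mul_assoc]
    · by_cases ht : t = cs.simple i <;> simp [h, ht, add_assoc, h2]

open Classical in
theorem signedConj_apply (i : I) (p : W × ZMod 2) :
    cs.signedConj i p =
      (cs.simple i * p.1 * cs.simple i, p.2 + if p.1 = cs.simple i then 1 else 0) := rfl

-- The sign records the parity of the number of occurrences of `t` in the right inversion sequence.
-- Once the action is known to factor through `W`, this parity depends only on the group element.
open Classical in
theorem prod_signedConj_apply (ω : List I) (t : W) (ε : ZMod 2) :
    (ω.map cs.signedConj).prod (t, ε) =
      (cs.wordProd ω * t * (cs.wordProd ω)⁻¹, ε + ((cs.rightInvSeq ω).count t : ℕ)) := by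
  induction ω with
  | nil => simp
  | cons i ω ih =>
    rw [List.map_cons, List.prod_cons, Equiv.Perm.mul_apply, ih, signedConj_apply]
    have h : cs.wordProd ω * t * (cs.wordProd ω)⁻¹ = cs.simple i ↔
        (cs.wordProd ω)⁻¹ * cs.simple i * cs.wordProd ω = t := by
      constructor
      · intro h; rw [← h]; group
      · intro h; rw [← h]; group
    ext
    · simp [wordProd_cons, mul_assoc]
    · simp [rightInvSeq, List.count_cons, h, add_assoc]

theorem leftInvSeq_eq_map_conj_rightInvSeq (ω : List I) :
    cs.leftInvSeq ω = (cs.rightInvSeq ω).map (MulAut.conj (cs.wordProd ω)) := by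
  induction ω with
  | nil => simp
  | cons i ω ih =>
    rw [leftInvSeq, ih, rightInvSeq, List.map_cons, List.map_map]
    congr 1
    · simp [wordProd_cons, mul_assoc]
    · apply List.map_congr_left
      intro t _
      simp [wordProd_cons, mul_assoc]

theorem prod_map_alternatingWord_two_mul {G : Type*} [Monoid G] (f : I → G) (i j : I) (p : ℕ) :
    ((alternatingWord i j (2 * p)).map f).prod = (f i * f j) ^ p := by
  induction p with
  | zero => simp [alternatingWord]
  | succ p ih =>
    rw [show 2 * (p + 1) = 2 * p + 1 + 1 by ring, alternatingWord_succ, alternatingWord_succ,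
      pow_succ, ← ih]
    simp

theorem wordProd_alternatingWord_add_two_mul (i j : I) (n : ℕ) :
    cs.wordProd (alternatingWord j i (2 * M i j + n)) = cs.wordProd (alternatingWord j i n) := by
  rw [prod_alternatingWord_eq_mul_pow, prod_alternatingWord_eq_mul_pow,
    Nat.mul_add_div (by norm_num), pow_add, simple_mul_simple_pow', one_mul]
  simp [Nat.even_add]

-- The word has trivial product, so its right and left inversion sequences coincide. The latter has
-- `2 * M i j` terms and repeats with period `M i j`, so every element occurs an even number of
-- times.
open Classical in
theorem even_count_rightInvSeq_alternatingWord (i j : I) (t : W) :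
    Even ((cs.rightInvSeq (alternatingWord i j (2 * M i j))).count t) := by
  set ω := alternatingWord i j (2 * M i j) with hω
  have h1 : cs.wordProd ω = 1 := by
    rw [wordProd, hω, prod_map_alternatingWord_two_mul, simple_mul_simple_pow]
  have h2 : cs.rightInvSeq ω = cs.leftInvSeq ω := by
    rw [leftInvSeq_eq_map_conj_rightInvSeq, h1]
    simp
  have h3 : cs.leftInvSeq ω =
      (List.range (M i j + M i j)).map
        fun k => cs.wordProd (alternatingWord j i (2 * k + 1)) := by
    apply List.ext_getElem
    · simp [hω, two_mul]
    · intro k hk hk'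
      rw [List.getElem_map, List.getElem_range]
      exact cs.getElem_leftInvSeq_alternatingWord i j _ k (by simpa [hω] using hk)
  rw [h2, h3, List.range_add, List.map_append, List.count_append, List.map_map]
  have h4 : ((fun k => cs.wordProd (alternatingWord j i (2 * k + 1))) ∘ fun x => M i j + x) =
      fun k => cs.wordProd (alternatingWord j i (2 * k + 1)) := by
    funext k
    simp only [Function.comp]
    rw [mul_add, add_assoc, wordProd_alternatingWord_add_two_mul]
  rw [h4]
  exact ⟨_, rfl⟩

theorem isLiftable_signedConj : M.IsLiftable cs.signedConj := by
  classical
  intro i j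
  rw [← prod_map_alternatingWord_two_mul]
  ext1 ⟨t, ε⟩
  rw [prod_signedConj_apply]
  have h : cs.wordProd (alternatingWord i j (2 * M i j)) = 1 := by
    rw [wordProd, prod_map_alternatingWord_two_mul, simple_mul_simple_pow]
  rw [h, (ZMod.natCast_eq_zero_iff_even).mpr (cs.even_count_rightInvSeq_alternatingWord i j t)]
  simp

theorem simple_mem_rightInvSeq {ω : List I} {i : I} (h : cs.IsRightDescent (cs.wordProd ω) i) :
    cs.simple i ∈ cs.rightInvSeq ω := by
  classical
  by_contra hmem
  obtain ⟨ω', hω', hw⟩ := cs.exists_isReduced (cs.wordProd ω * cs.simple i)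
  set φ := cs.lift ⟨_, cs.isLiftable_signedConj⟩ with hφ
  have hφω : ∀ η : List I, φ (cs.wordProd η) = (η.map cs.signedConj).prod := by
    intro η
    rw [wordProd, map_list_prod, List.map_map]
    congr 1
    apply List.map_congr_left
    intro k _
    exact cs.lift_apply_simple _ k
  -- Multiplying by `s_i` flips the sign at `s_i`, so absence from the sequence of `ω` forces an odd
  -- count for `ω'`. Then `s_i` would be an inversion of `w s_i`, against the descent.
  have h1 : φ (cs.wordProd ω') (cs.simple i, 0) = φ (cs.wordProd ω) (cs.simple i, 1) := by
    rw [← hw, map_mul, Equiv.Perm.mul_apply, hφ, cs.lift_apply_simple, signedConj_apply]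
    simp
  rw [hφω, hφω, prod_signedConj_apply, prod_signedConj_apply, List.count_eq_zero.mpr hmem] at h1
  have h2 := congrArg Prod.snd h1
  simp only [Nat.cast_zero, add_zero, zero_add] at h2
  have h3 : cs.simple i ∈ cs.rightInvSeq ω' := by
    by_contra hn
    rw [List.count_eq_zero.mpr hn] at h2
    exact absurd h2 (by decide)
  have h4 := (cs.isRightInversion_of_mem_rightInvSeq hω' h3).2
  rw [← hw, simple_mul_simple_cancel_right] at h4
  exact absurd h (not_lt.mpr h4.le)

/-- The exchange condition. -/
theorem exists_eraseIdx_of_isRightDescent {ω : List I} {i : I}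
    (h : cs.IsRightDescent (cs.wordProd ω) i) :
    ∃ k < ω.length, cs.wordProd ω * cs.simple i = cs.wordProd (ω.eraseIdx k) := by
  obtain ⟨k, hk, hki⟩ := List.mem_iff_getElem.mp (cs.simple_mem_rightInvSeq h)
  refine ⟨k, by simpa using hk, ?_⟩
  rw [← wordProd_mul_getD_rightInvSeq, List.getD_eq_getElem _ 1 hk, hki]

theorem length_wordProd_eraseIdx_lt {ω : List I} {k : ℕ} (hk : k < ω.length) :
    cs.length (cs.wordProd (ω.eraseIdx k)) < ω.length := by
  have h1 := cs.length_wordProd_le (ω.eraseIdx k)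
  have h2 := List.length_eraseIdx_add_one hk
  omega

/-- The exchange condition for a product of two words. -/
theorem exists_eraseIdx_of_isRightDescent_mul {α β : List I} {i : I}
    (h : cs.IsRightDescent (cs.wordProd α * cs.wordProd β) i) :
    (∃ k < α.length, cs.wordProd α * cs.wordProd β * cs.simple i =
      cs.wordProd (α.eraseIdx k) * cs.wordProd β) ∨
    ∃ k < β.length, cs.wordProd β * cs.simple i = cs.wordProd (β.eraseIdx k) := by
  rw [← wordProd_append] at h ⊢
  obtain ⟨k, hk, he⟩ := cs.exists_eraseIdx_of_isRightDescent h
  rw [List.length_append] at hk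
  rcases lt_or_ge k α.length with h1 | h1
  · left
    refine ⟨k, h1, ?_⟩
    rw [he, List.eraseIdx_append_of_lt_length h1, wordProd_append]
  · right
    refine ⟨k - α.length, by omega, ?_⟩
    rw [List.eraseIdx_append_of_length_le h1, wordProd_append, wordProd_append, mul_assoc] at he
    exact mul_left_cancel he

/-! ### Standard parabolic subgroups -/

/-- The standard parabolic subgroup generated by the simple reflections in `J`. -/
def parabolic (J : Set I) : Subgroup W := Subgroup.closure (cs.simple '' J)

variable {cs} {J : Set I}

theorem simple_mem_parabolic {j : I} (hj : j ∈ J) : cs.simple j ∈ cs.parabolic J :=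
  Subgroup.subset_closure ⟨j, hj, rfl⟩

theorem wordProd_mem_parabolic {ω : List I} (h : ∀ i ∈ ω, i ∈ J) :
    cs.wordProd ω ∈ cs.parabolic J := by
  apply Subgroup.list_prod_mem
  simp only [List.mem_map]
  rintro _ ⟨i, hi, rfl⟩
  exact simple_mem_parabolic (h i hi)

theorem wordProd_eraseIdx_mem_parabolic {ω : List I} (h : ∀ i ∈ ω, i ∈ J) (k : ℕ) :
    cs.wordProd (ω.eraseIdx k) ∈ cs.parabolic J :=
  wordProd_mem_parabolic fun i hi => h i (List.mem_of_mem_eraseIdx hi)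

theorem exists_isReduced_of_mem_parabolic {w : W} (hw : w ∈ cs.parabolic J) :
    ∃ ω : List I, cs.IsReduced ω ∧ (∀ i ∈ ω, i ∈ J) ∧ w = cs.wordProd ω := by
  have step : ∀ (w : W) (j : I), j ∈ J →
      (∃ ω : List I, cs.IsReduced ω ∧ (∀ i ∈ ω, i ∈ J) ∧ w = cs.wordProd ω) →
      ∃ ω : List I, cs.IsReduced ω ∧ (∀ i ∈ ω, i ∈ J) ∧ w * cs.simple j = cs.wordProd ω := by
    rintro w j hj ⟨ω, hω, hJ, rfl⟩
    rcases cs.length_mul_simple (cs.wordProd ω) j with h | h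
    · refine ⟨ω ++ [j], ?_, ?_, by simp [wordProd_append]⟩
      · rw [IsReduced, wordProd_append, wordProd_singleton, h, hω.eq]
        simp
      · intro i hi
        rcases List.mem_append.mp hi with hi | hi
        · exact hJ i hi
        · rw [List.mem_singleton.mp hi]; exact hj
    · obtain ⟨k, hk, he⟩ := cs.exists_eraseIdx_of_isRightDescent (ω := ω) (i := j)
        (by rw [IsRightDescent]; omega)
      refine ⟨ω.eraseIdx k, ?_, fun i hi => hJ i (List.mem_of_mem_eraseIdx hi), he⟩
      have := List.length_eraseIdx_add_one hk
      have := hω.eq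
      rw [IsReduced, ← he]
      omega
  induction hw using Subgroup.closure_induction_right with
  | one => exact ⟨[], by simp [IsReduced], by simp, by simp⟩
  | mul_right x _ y hy ih =>
    obtain ⟨j, hj, rfl⟩ := hy
    exact step x j hj ih
  | mul_inv_cancel x _ y hy ih =>
    obtain ⟨j, hj, rfl⟩ := hy
    rw [inv_simple]
    exact step x j hj ih

theorem mem_of_simple_mem_parabolic {i : I} (h : cs.simple i ∈ cs.parabolic J) : i ∈ J := by
  obtain ⟨ω, hω, hJ, hi⟩ := exists_isReduced_of_mem_parabolic h
  have h1 := hω.eq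
  rw [← hi, length_simple] at h1
  obtain ⟨k, rfl⟩ := List.length_eq_one_iff.mp h1.symm
  rw [wordProd_singleton] at hi
  rw [cs.simple_injective hi]
  exact hJ k (by simp)

theorem exists_simple_of_mem_parabolic {w : W} (hw : w ∈ cs.parabolic J) (h1 : cs.length w = 1) :
    ∃ j ∈ J, w = cs.simple j := by
  obtain ⟨j, rfl⟩ := cs.length_eq_one_iff.mp h1
  exact ⟨j, mem_of_simple_mem_parabolic hw, rfl⟩

theorem exists_rightDescent_of_mem_parabolic {w : W} (hw : w ∈ cs.parabolic J) (h1 : w ≠ 1) :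
    ∃ j ∈ J, cs.IsRightDescent w j := by
  obtain ⟨j, hj⟩ := cs.exists_rightDescent_of_ne_one h1
  refine ⟨j, ?_, hj⟩
  obtain ⟨ω, hω, hJ, rfl⟩ := exists_isReduced_of_mem_parabolic hw
  obtain ⟨k, hk, he⟩ := cs.exists_eraseIdx_of_isRightDescent hj
  apply mem_of_simple_mem_parabolic (cs := cs)
  rw [← inv_mul_cancel_left (cs.wordProd ω) (cs.simple j), he]
  exact mul_mem (inv_mem hw) (wordProd_eraseIdx_mem_parabolic hJ k)

variable (cs)

/-- `r` has minimal length in the coset `r W_J`. -/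
def IsRightMin (J : Set I) (r : W) : Prop :=
  ∀ y ∈ cs.parabolic J, cs.length r ≤ cs.length (r * y)

theorem exists_isRightMin_mul (J : Set I) (w : W) :
    ∃ r y, cs.IsRightMin J r ∧ y ∈ cs.parabolic J ∧ w = r * y := by
  obtain ⟨y, hy, hmin⟩ := exists_minimalFor_of_wellFoundedLT (fun y => y ∈ cs.parabolic J)
    (fun y => cs.length (w * y)) ⟨1, one_mem _⟩
  refine ⟨w * y, y⁻¹, ?_, inv_mem hy, by simp⟩
  intro z hz
  by_contra hlt
  have := hmin (mul_mem hy hz) (by simpa [mul_assoc] using (not_le.mp hlt).le)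
  simp only [← mul_assoc] at this
  exact hlt this

variable {cs}

namespace IsRightMin

variable {r : W} (hr : cs.IsRightMin J r)

-- If appending `j` lowered the length, the exchange condition would delete a letter either from a
-- reduced word of `r`, against minimality in `r W_J`, or from `ω`, against the reducedness of `ω
-- j`.
include hr in
theorem length_mul_wordProd {ω : List I} (hω : cs.IsReduced ω) (hJ : ∀ i ∈ ω, i ∈ J) :
    cs.length (r * cs.wordProd ω) = cs.length r + ω.length := by
  induction ω using List.reverseRecOn with
  | nil => simp
  | append_singleton ω j ih =>
    have hω' : cs.IsReduced ω := by simpa using hω.take ω.length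
    have hJ' : ∀ i ∈ ω, i ∈ J := fun i hi => hJ i (by simp [hi])
    have hj : j ∈ J := hJ j (by simp)
    have ih := ih hω' hJ'
    rw [wordProd_append, wordProd_singleton, ← mul_assoc, List.length_append,
      List.length_singleton, ← add_assoc, ← ih]
    refine (cs.length_mul_simple _ _).resolve_right fun h => ?_
    obtain ⟨α, hα, rfl⟩ := cs.exists_isReduced r
    rcases cs.exists_eraseIdx_of_isRightDescent_mul (α := α) (β := ω) (i := j)
      (by rw [IsRightDescent]; omega) with ⟨k, hk, he⟩ | ⟨k, hk, he⟩
    · have h1 := cs.length_wordProd_eraseIdx_lt hk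
      rw [← hα.eq] at h1
      have h2 := hr (cs.wordProd ω * cs.simple j * (cs.wordProd ω)⁻¹)
        (mul_mem (mul_mem (wordProd_mem_parabolic hJ') (simple_mem_parabolic hj))
          (inv_mem (wordProd_mem_parabolic hJ')))
      rw [← mul_assoc, ← mul_assoc, he, mul_inv_cancel_right] at h2
      omega
    · have h1 := cs.length_wordProd_eraseIdx_lt hk
      have h2 := hω.eq
      rw [wordProd_append, wordProd_singleton, he, List.length_append] at h2
      omega

include hr in
theorem length_mul {y : W} (hy : y ∈ cs.parabolic J) :
    cs.length (r * y) = cs.length r + cs.length y := by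
  obtain ⟨ω, hω, hJ, rfl⟩ := exists_isReduced_of_mem_parabolic hy
  rw [hr.length_mul_wordProd hω hJ, hω.eq]

include hr in
theorem exists_simple {y : W} (hy : y ∈ cs.parabolic J) (h1 : y ≠ 1)
    (h : cs.length (r * y) ≤ cs.length r + 1) : ∃ j ∈ J, y = cs.simple j := by
  apply exists_simple_of_mem_parabolic hy
  have := hr.length_mul hy
  have : cs.length y ≠ 0 := fun h0 => h1 (cs.length_eq_zero_iff.mp h0)
  omega

include hr in
theorem exists_simple_mul_eq {i : I} (h : r⁻¹ * cs.simple i * r ∈ cs.parabolic J) :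
    ∃ j ∈ J, cs.simple i * r = r * cs.simple j := by
  obtain ⟨j, hj, he⟩ := hr.exists_simple h
    (fun h1 => by
      have h2 : cs.simple i = 1 := by simpa [mul_assoc, inv_mul_eq_one] using h1
      have := cs.length_simple i
      rw [h2, length_one] at this
      omega)
    (by
      rw [← mul_assoc, mul_inv_cancel_left]
      have := cs.length_mul_le (cs.simple i) r
      rw [length_simple] at this
      omega)
  exact ⟨j, hj, by rw [← he]; group⟩

include hr in
theorem length_mul_simple {j : I} (hj : j ∈ J) :
    cs.length (r * cs.simple j) = cs.length r + 1 := by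
  rw [hr.length_mul (simple_mem_parabolic hj), length_simple]

theorem of_not_isRightDescent (h : ∀ j ∈ J, ¬ cs.IsRightDescent r j) : cs.IsRightMin J r := by
  obtain ⟨r', y, hr', hy, rfl⟩ := cs.exists_isRightMin_mul J r
  rcases eq_or_ne y 1 with rfl | h1
  · simpa using hr'
  · obtain ⟨j, hj, hd⟩ := exists_rightDescent_of_mem_parabolic hy h1
    exfalso
    apply h j hj
    rw [IsRightDescent, mul_assoc, hr'.length_mul hy,
      hr'.length_mul (mul_mem hy (simple_mem_parabolic hj))]
    exact Nat.add_lt_add_left hd _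

include hr in
theorem eq_of_inv_mul_mem {r' : W} (hr' : cs.IsRightMin J r')
    (h : r⁻¹ * r' ∈ cs.parabolic J) : r = r' := by
  have h1 := hr.length_mul h
  rw [mul_inv_cancel_left] at h1
  have h2 := hr' _ (inv_mem h)
  rw [mul_inv_rev, inv_inv, mul_inv_cancel_left] at h2
  have h3 : cs.length (r⁻¹ * r') = 0 := by omega
  rw [length_eq_zero_iff, inv_mul_eq_one] at h3
  exact h3

-- Deodhar's lemma. If `s_i r` had a descent `j ∈ J` while longer than `r`, exchange would delete
-- either the letter `i`, giving `s_i r = r s_j`, or a letter of `r`, making `r s_j` too short. If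
-- `s_i r` is shorter than `r`, lengths alone exclude the descent.
include hr in
theorem simple_mul {i : I} (h : r⁻¹ * cs.simple i * r ∉ cs.parabolic J) :
    cs.IsRightMin J (cs.simple i * r) := by
  apply of_not_isRightDescent
  intro j hj hd
  have h1 := hr.length_mul_simple hj
  rcases cs.length_simple_mul r i with h2 | h2
  · obtain ⟨ω, hω, rfl⟩ := cs.exists_isReduced r
    rw [← wordProd_singleton] at hd
    rcases cs.exists_eraseIdx_of_isRightDescent_mul hd with ⟨k, hk, he⟩ | ⟨k, hk, he⟩
    · have hk0 : k = 0 := by simpa using hk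
      subst hk0
      simp only [wordProd_singleton, List.eraseIdx_cons_zero, wordProd_nil, one_mul] at he
      apply h
      have : (cs.wordProd ω)⁻¹ * cs.simple i * cs.wordProd ω = cs.simple j := by
        have h3 : cs.simple i * cs.wordProd ω = cs.wordProd ω * cs.simple j := by
          rw [← cs.simple_mul_simple_cancel_right (w := cs.simple i * cs.wordProd ω) j, he]
        rw [mul_assoc, h3, inv_mul_cancel_left]
      rw [this]
      exact simple_mem_parabolic hj
    · have h3 := cs.length_wordProd_eraseIdx_lt hk
      rw [← he, h1, hω.eq] at h3
      omega
  · rw [IsRightDescent, mul_assoc] at hd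
    have := cs.length_simple_mul (r * cs.simple j) i
    omega

include hr in
theorem of_simple_mul_lt {i : I} (h : cs.IsLeftDescent r i) :
    r⁻¹ * cs.simple i * r ∉ cs.parabolic J := by
  intro hm
  obtain ⟨j, hj, he⟩ := hr.exists_simple_mul_eq hm
  have := hr.length_mul_simple hj
  rw [IsLeftDescent, he] at h
  omega

end IsRightMin

end CoxeterSystem

namespace CoxeterSystem

variable {I W : Type*} [Group W] {M : CoxeterMatrix I} {cs : CoxeterSystem M W}

/-! ### Dihedral subgroups -/

theorem IsReduced.eq_alternatingWord {i j : I} {ω : List I} (hω : cs.IsReduced ω)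
    (h : ∀ k ∈ ω, k = i ∨ k = j) :
    ω = alternatingWord i j ω.length ∨ ω = alternatingWord j i ω.length := by
  induction ω using List.reverseRecOn with
  | nil => simp [alternatingWord]
  | append_singleton ω k ih =>
    have hω' : cs.IsReduced ω := by simpa using hω.take ω.length
    have key : ∀ a b : I, ω = alternatingWord a b ω.length → k ≠ b ∨ ω = [] := by
      intro a b hab
      by_contra! hc
      obtain ⟨rfl, h0⟩ := hc
      obtain ⟨n, hn⟩ := Nat.exists_eq_succ_of_ne_zero (mt List.length_eq_zero_iff.mp h0)
      rw [hn, Nat.succ_eq_add_one, alternatingWord_succ, List.concat_eq_append] at hab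
      have h1 := hω.eq
      rw [hab, wordProd_append, wordProd_append, wordProd_singleton,
        simple_mul_simple_cancel_right] at h1
      have h2 := cs.length_wordProd_le (alternatingWord k a n)
      simp at h1 h2
      omega
    simp only [List.length_append, List.length_singleton, alternatingWord_succ,
      List.concat_eq_append]
    have hk := h k (by simp)
    rcases eq_or_ne ω [] with rfl | h0
    · rcases hk with rfl | rfl <;> simp [alternatingWord]
    rcases ih hω' fun k hk => h k (by simp [hk]) with hab | hab
    · have := (key _ _ hab).resolve_right h0
      right
      rw [hk.resolve_right this, ← hab]
    · have := (key _ _ hab).resolve_right h0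
      left
      rw [hk.resolve_left this, ← hab]

theorem eq_wordProd_alternatingWord {i j : I} (hij : i ≠ j) {y : W}
    (hy : y ∈ cs.parabolic {i, j}) (hd : cs.IsRightDescent y i) :
    y = cs.wordProd (alternatingWord j i (cs.length y)) := by
  obtain ⟨ω, hω, hJ, he⟩ := exists_isReduced_of_mem_parabolic
    (mul_mem hy (simple_mem_parabolic (cs := cs) (J := {i, j}) (j := i) (by simp)))
  have hy' : y = cs.wordProd (ω ++ [i]) := by
    rw [wordProd_append, wordProd_singleton, ← he, simple_mul_simple_cancel_right]
  have hlen : cs.length y = ω.length + 1 := by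
    rw [← hω.eq, ← he]
    exact (cs.isRightDescent_iff.mp hd).symm
  have hω' : cs.IsReduced (ω ++ [i]) := by
    rw [IsReduced, ← hy', hlen]
    simp
  rcases hω'.eq_alternatingWord (i := i) (j := j) (by
    intro k hk
    rcases List.mem_append.mp hk with hk | hk
    · simpa using hJ k hk
    · left; simpa using hk) with h | h
  · rw [List.length_append, List.length_singleton, alternatingWord_succ,
      List.concat_eq_append] at h
    exact absurd (by simpa using (List.append_inj' h rfl).2) hij
  · rw [List.length_append, List.length_singleton, ← hlen] at h
    rw [← h, ← hy']

theorem simple_mul_simple_pow_eq_one {i j : I} {n : ℕ}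
    (h : cs.wordProd (alternatingWord i j n) = cs.wordProd (alternatingWord j i n)) :
    (cs.simple i * cs.simple j) ^ n = 1 := by
  have hinv : (cs.simple j * cs.simple i) = (cs.simple i * cs.simple j)⁻¹ := by simp
  rw [prod_alternatingWord_eq_mul_pow, prod_alternatingWord_eq_mul_pow] at h
  rcases Nat.even_or_odd' n with ⟨k, rfl | rfl⟩
  · rw [hinv] at h
    simp only [even_two, Even.mul_right, ↓reduceIte, one_mul, inv_pow] at h
    rw [Nat.mul_div_cancel_left k (by norm_num)] at h
    rw [two_mul, pow_add]
    nth_rw 1 [h]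
    simp
  · simp only [Nat.not_even_bit1, ↓reduceIte] at h
    rw [show (2 * k + 1) / 2 = k by omega] at h
    have h1 := congrArg (cs.simple i * ·) h
    simp only [← mul_assoc] at h1
    rw [hinv, ← pow_succ', simple_mul_simple_self, one_mul, inv_pow] at h1
    rw [show 2 * k + 1 = k + 1 + k by ring, pow_add, h1]
    simp

/-- Both descents pass to the dihedral factor `y` of `w`, which therefore equals the alternating
words of length `ℓ(y)` with either ending. Their equality makes the order `M i j` divide `ℓ(y)`,
while longer alternating words are not reduced, so `ℓ(y) = M i j`. -/
theorem exists_eq_mul_braidWord {w : W} {i j : I} (hij : i ≠ j)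
    (hi : cs.IsRightDescent w i) (hj : cs.IsRightDescent w j) :
    M i j ≠ 0 ∧ ∃ x, w = x * cs.wordProd (braidWord M i j) ∧ cs.length w = cs.length x + M i j := by
  obtain ⟨x, y, hx, hy, rfl⟩ := cs.exists_isRightMin_mul {i, j} w
  have hdesc : ∀ k ∈ ({i, j} : Set I), cs.IsRightDescent (x * y) k → cs.IsRightDescent y k := by
    intro k hk h
    rw [IsRightDescent, mul_assoc, hx.length_mul hy,
      hx.length_mul (mul_mem hy (simple_mem_parabolic hk))] at h
    exact Nat.lt_of_add_lt_add_left h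
  have hi := hdesc i (by simp) hi
  have hj := hdesc j (by simp) hj
  have h1 := eq_wordProd_alternatingWord hij hy hi
  have h2 := eq_wordProd_alternatingWord hij.symm (by rwa [Set.pair_comm]) hj
  have hdvd := cs.dvd_of_simple_mul_simple_pow_eq_one hij
    (simple_mul_simple_pow_eq_one (h2.symm.trans h1))
  have hpos : cs.length y ≠ 0 := by
    rw [IsRightDescent] at hi
    omega
  have h0 : M i j ≠ 0 := fun h0 => hpos (by rwa [h0, zero_dvd_iff] at hdvd)
  have hle : cs.length y ≤ M i j := by
    by_contra hlt
    apply cs.not_isReduced_alternatingWord i j h0 (not_le.mp hlt)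
    rw [IsReduced, ← h2, length_alternatingWord]
  have heq : cs.length y = M i j := le_antisymm hle (Nat.le_of_dvd (Nat.pos_of_ne_zero hpos) hdvd)
  refine ⟨h0, x, ?_, by rw [hx.length_mul hy, heq]⟩
  rw [heq] at h2
  rw [braidWord, ← h2]

variable (cs) in
theorem isReduced_alternatingWord {i j : I} (hij : i ≠ j) {n : ℕ} (hn : n ≤ M i j) :
    cs.IsReduced (alternatingWord i j n) := by
  induction n generalizing i j with
  | zero => simp [alternatingWord, IsReduced]
  | succ n ih =>
    have hji : M j i = M i j := M.symmetric j i
    have h1 := ih hij.symm (by rw [hji]; omega)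
    rw [IsReduced, alternatingWord_succ, wordProd_concat, List.length_concat,
      length_alternatingWord]
    have h1' := h1.eq
    rw [length_alternatingWord] at h1'
    refine (cs.length_mul_simple _ j).elim (fun h => by rw [h, h1']) fun h => ?_
    exfalso
    rcases n with - | n
    · simp [alternatingWord] at h
    · have hi : cs.IsRightDescent (cs.wordProd (alternatingWord j i (n + 1))) i := by
        rw [IsRightDescent, h1', alternatingWord_succ, wordProd_concat,
          simple_mul_simple_cancel_right]
        have := cs.length_wordProd_le (alternatingWord i j n)
        rw [length_alternatingWord] at this
        omega
      obtain ⟨-, x, -, hx⟩ := exists_eq_mul_braidWord hij hi (by rw [IsRightDescent]; omega)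
      omega

/-! ### Matsumoto's theorem -/

/-- **Matsumoto's theorem**: a family of elements of a monoid satisfying the braid relations
takes the same product on all reduced words of an element. -/
theorem prod_map_eq_of_isReduced {N : Type*} [Monoid N] {f : I → N}
    (hf : ∀ i j, ((braidWord M i j).map f).prod = ((braidWord M j i).map f).prod)
    {ω ω' : List I} (hω : cs.IsReduced ω) (hω' : cs.IsReduced ω')
    (h : cs.wordProd ω = cs.wordProd ω') : (ω.map f).prod = (ω'.map f).prod := by
  induction hn : ω.length generalizing ω ω' with
  | zero =>
    have h' : ω'.length = 0 := by rw [← hω'.eq, ← h, hω.eq, hn]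
    rw [List.length_eq_zero_iff.mp hn, List.length_eq_zero_iff.mp h']
  | succ n ih =>
    have same : ∀ {α β : List I} {i : I}, cs.IsReduced (α ++ [i]) → cs.IsReduced (β ++ [i]) →
        cs.wordProd (α ++ [i]) = cs.wordProd (β ++ [i]) → (α ++ [i]).length = n + 1 →
        ((α ++ [i]).map f).prod = ((β ++ [i]).map f).prod := by
      intro α β i hα hβ he hl
      rw [wordProd_append, wordProd_append] at he
      rw [List.map_append, List.map_append, List.prod_append, List.prod_append,
        ih (by simpa using hα.take α.length) (by simpa using hβ.take β.length)
          (mul_right_cancel he) (by simpa using hl)]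
    have hn' : ω'.length = n + 1 := by rw [← hω'.eq, ← h, hω.eq, hn]
    obtain ⟨α, i, rfl⟩ := (List.eq_nil_or_concat' ω).resolve_left (by rintro rfl; simp at hn)
    obtain ⟨β, j, rfl⟩ := (List.eq_nil_or_concat' ω').resolve_left (by rintro rfl; simp at hn')
    rcases eq_or_ne i j with rfl | hij
    · exact same hω hω' h hn
    have desc : ∀ {α : List I} {i : I}, cs.IsReduced (α ++ [i]) →
        cs.IsRightDescent (cs.wordProd (α ++ [i])) i := by
      intro α i hα
      rw [IsRightDescent, hα.eq, wordProd_append, wordProd_singleton,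
        simple_mul_simple_cancel_right, List.length_append, List.length_singleton]
      exact Nat.lt_succ_of_le (cs.length_wordProd_le α)
    -- When the last letters differ, two intermediate reduced words, `γ` followed by either braid
    -- word, share their last letters with `ω` and `ω'` and differ from each other by one braid
    -- relation.
    obtain ⟨h0, x, hx, hl⟩ := exists_eq_mul_braidWord hij (desc hω) (h ▸ desc hω')
    obtain ⟨γ, hγ, rfl⟩ := cs.exists_isReduced x
    obtain ⟨m, hm⟩ := Nat.exists_eq_succ_of_ne_zero h0
    have hbr : cs.wordProd (braidWord M i j) = cs.wordProd (braidWord M j i) :=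
      cs.wordProd_braidWord_eq i j
    have hji : M j i = m + 1 := by rw [M.symmetric, hm]
    have e1 : γ ++ braidWord M j i = (γ ++ alternatingWord i j m) ++ [i] := by
      rw [braidWord, hji, alternatingWord_succ]; simp
    have e2 : γ ++ braidWord M i j = (γ ++ alternatingWord j i m) ++ [j] := by
      rw [braidWord, hm, Nat.succ_eq_add_one, alternatingWord_succ]; simp
    have p1 : cs.wordProd (γ ++ braidWord M j i) = cs.wordProd (α ++ [i]) := by
      rw [wordProd_append, ← hbr, hx]
    have p2 : cs.wordProd (γ ++ braidWord M i j) = cs.wordProd (α ++ [i]) := by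
      rw [wordProd_append, hx]
    have r1 : cs.IsReduced (γ ++ braidWord M j i) := by
      rw [IsReduced, p1, hl, hγ.eq, List.length_append, length_alternatingWord, M.symmetric j i]
    have r2 : cs.IsReduced (γ ++ braidWord M i j) := by
      rw [IsReduced, p2, hl, hγ.eq, List.length_append, length_alternatingWord]
    have q1 := same hω (e1 ▸ r1) (by rw [← e1, p1]) hn
    have q2 := same hω' (e2 ▸ r2) (by rw [← e2, p2, h]) hn'
    rw [q1, q2, ← e1, ← e2, List.map_append, List.map_append, List.prod_append, List.prod_append,
      hf i j]

end CoxeterSystem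

namespace CoxeterSystem

variable {I W : Type*} [Group W] {M : CoxeterMatrix I} (cs : CoxeterSystem M W) {J : Set I}

/-! ### Minimal representatives of cosets -/

theorem exists_isRightMin_mk_eq (c : W ⧸ cs.parabolic J) :
    ∃ r : W, cs.IsRightMin J r ∧ (r : W ⧸ cs.parabolic J) = c := by
  induction c using QuotientGroup.induction_on with
  | H w =>
    obtain ⟨r, y, hr, hy, rfl⟩ := cs.exists_isRightMin_mul J w
    exact ⟨r, hr, by rw [QuotientGroup.eq]; simpa using hy⟩

/-- The element of minimal length of a coset of a standard parabolic subgroup. -/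
noncomputable def minRep (c : W ⧸ cs.parabolic J) : W := (cs.exists_isRightMin_mk_eq c).choose

theorem isRightMin_minRep (c : W ⧸ cs.parabolic J) : cs.IsRightMin J (cs.minRep c) :=
  (cs.exists_isRightMin_mk_eq c).choose_spec.1

@[simp]
theorem mk_minRep (c : W ⧸ cs.parabolic J) : (cs.minRep c : W ⧸ cs.parabolic J) = c :=
  (cs.exists_isRightMin_mk_eq c).choose_spec.2

variable {cs}

theorem IsRightMin.minRep_mk {r : W} (hr : cs.IsRightMin J r) :
    cs.minRep (r : W ⧸ cs.parabolic J) = r :=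
  (cs.isRightMin_minRep _).eq_of_inv_mul_mem hr (QuotientGroup.eq.mp (cs.mk_minRep _))

theorem isRightMin_one : cs.IsRightMin J 1 := fun y _ => by simp

theorem smul_eq_self_iff (w : W) (c : W ⧸ cs.parabolic J) :
    w • c = c ↔ (cs.minRep c)⁻¹ * w * cs.minRep c ∈ cs.parabolic J := by
  nth_rw 1 2 [← cs.mk_minRep c]
  rw [← inv_mem_iff, eq_comm (a := w • _)]
  change ((cs.minRep c : W) : W ⧸ cs.parabolic J) = ((w * cs.minRep c : W) : W ⧸ cs.parabolic J) ↔ _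
  rw [QuotientGroup.eq, ← inv_mem_iff, mul_assoc]

theorem minRep_simple_smul {i : I} {c : W ⧸ cs.parabolic J} (h : cs.simple i • c ≠ c) :
    cs.minRep (cs.simple i • c) = cs.simple i * cs.minRep c := by
  have h1 := (cs.isRightMin_minRep c).simple_mul (mt (smul_eq_self_iff _ _).mpr h)
  rw [← h1.minRep_mk]
  nth_rw 1 [← cs.mk_minRep c]
  rfl

theorem exists_simple_mul_minRep {i : I} {c : W ⧸ cs.parabolic J} (h : cs.simple i • c = c) :
    ∃ j ∈ J, cs.simple i * cs.minRep c = cs.minRep c * cs.simple j :=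
  (cs.isRightMin_minRep c).exists_simple_mul_eq ((smul_eq_self_iff _ _).mp h)

@[simp]
theorem simple_smul_simple_smul (i : I) (c : W ⧸ cs.parabolic J) :
    cs.simple i • cs.simple i • c = c := by
  rw [smul_smul, simple_mul_simple_self, one_smul]

end CoxeterSystem

namespace ArtinTits

open CoxeterSystem

variable {I : Type*} (M : CoxeterMatrix I)

/-! ### The canonical section -/

theorem prod_map_sigma_braidWord (i j : I) :
    ((braidWord M i j).map (sigma M)).prod = ((braidWord M j i).map (sigma M)).prod := by
  have h : PresentedGroup.mk (braidRelators M) (braidRelator M i j) = 1 :=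
    PresentedGroup.one_of_mem ⟨(i, j), rfl⟩
  rw [braidRelator, map_mul, map_inv, map_list_prod, map_list_prod, List.map_map, List.map_map,
    mul_inv_eq_one] at h
  exact h

variable {M}

theorem kappa_wordProd {ω : List I} (hω : M.toCoxeterSystem.IsReduced ω) :
    kappa M (M.toCoxeterSystem.wordProd ω) = (ω.map (sigma M)).prod := by
  have h := (M.toCoxeterSystem.exists_isReduced (M.toCoxeterSystem.wordProd ω)).choose_spec
  exact prod_map_eq_of_isReduced (prod_map_sigma_braidWord M) h.1 hω h.2.symm

theorem kappa_mul {u v : M.Group}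
    (h : M.toCoxeterSystem.length (u * v) =
      M.toCoxeterSystem.length u + M.toCoxeterSystem.length v) :
    kappa M (u * v) = kappa M u * kappa M v := by
  obtain ⟨α, hα, rfl⟩ := M.toCoxeterSystem.exists_isReduced u
  obtain ⟨β, hβ, rfl⟩ := M.toCoxeterSystem.exists_isReduced v
  have hr : M.toCoxeterSystem.IsReduced (α ++ β) := by
    rw [CoxeterSystem.IsReduced, wordProd_append, h, hα.eq, hβ.eq, List.length_append]
  rw [kappa_wordProd hα, kappa_wordProd hβ, ← wordProd_append, kappa_wordProd hr, List.map_append,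
    List.prod_append]

@[simp]
theorem kappa_one : kappa M 1 = 1 := by
  rw [← M.toCoxeterSystem.wordProd_nil, kappa_wordProd (by simp [CoxeterSystem.IsReduced])]
  simp

theorem kappa_simple (i : I) : kappa M (M.toCoxeterSystem.simple i) = sigma M i := by
  rw [← wordProd_singleton, kappa_wordProd (by
    rw [CoxeterSystem.IsReduced, wordProd_singleton, length_simple, List.length_singleton])]
  simp

theorem coxeterParabolic_eq (X : Set I) :
    coxeterParabolic M X = M.toCoxeterSystem.parabolic X := rfl

theorem sigma_mem_artinParabolic {X : Set I} {i : I} (hi : i ∈ X) :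
    sigma M i ∈ artinParabolic M X :=
  Subgroup.subset_closure ⟨i, hi, rfl⟩

theorem kappa_mem_artinParabolic {X : Set I} {w : M.Group} (hw : w ∈ coxeterParabolic M X) :
    kappa M w ∈ artinParabolic M X := by
  obtain ⟨ω, hω, hX, rfl⟩ := exists_isReduced_of_mem_parabolic (cs := M.toCoxeterSystem) hw
  rw [kappa_wordProd hω]
  apply Subgroup.list_prod_mem
  simp only [List.mem_map]
  rintro _ ⟨i, hi, rfl⟩
  exact sigma_mem_artinParabolic (hX i hi)

variable (M) in
/-- The canonical projection of the Artin-Tits group onto the Coxeter group. -/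
def toCoxeter : ArtinGroup M →* M.Group :=
  PresentedGroup.toGroup (f := M.toCoxeterSystem.simple) <| by
    rintro _ ⟨⟨i, j⟩, rfl⟩
    rw [Function.uncurry, braidRelator, map_mul, map_inv, map_list_prod, map_list_prod,
      List.map_map, List.map_map, mul_inv_eq_one]
    simpa [Function.comp_def, wordProd] using M.toCoxeterSystem.wordProd_braidWord_eq i j

@[simp]
theorem toCoxeter_sigma (i : I) : toCoxeter M (sigma M i) = M.toCoxeterSystem.simple i :=
  PresentedGroup.toGroup.of _

@[simp]
theorem toCoxeter_kappa (w : M.Group) : toCoxeter M (kappa M w) = w := by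
  obtain ⟨ω, hω, rfl⟩ := M.toCoxeterSystem.exists_isReduced w
  rw [kappa_wordProd hω, map_list_prod, List.map_map, wordProd]
  congr 1

theorem toCoxeter_mem_coxeterParabolic {X : Set I} {a : ArtinGroup M}
    (ha : a ∈ artinParabolic M X) : toCoxeter M a ∈ coxeterParabolic M X := by
  have h : artinParabolic M X ≤ (coxeterParabolic M X).comap (toCoxeter M) := by
    rw [artinParabolic, Subgroup.closure_le]
    rintro _ ⟨i, hi, rfl⟩
    rw [SetLike.mem_coe, Subgroup.mem_comap, toCoxeter_sigma, coxeterParabolic_eq]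
    exact simple_mem_parabolic (cs := M.toCoxeterSystem) hi
  exact h ha

/-! ### The action of the Artin-Tits group on twisted cosets -/

variable {Y : Set I}

open Classical in
/-- The generator `σ j` with `j ∈ Y` and `s i * r = r * s j`, where `r` is the minimal
representative of the coset `c`, if it exists, and `1` otherwise. -/
noncomputable def emission (i : I) (c : M.Group ⧸ M.toCoxeterSystem.parabolic Y) : ArtinGroup M :=
  if h : ∃ j ∈ Y, M.toCoxeterSystem.simple i * M.toCoxeterSystem.minRep c =
      M.toCoxeterSystem.minRep c * M.toCoxeterSystem.simple j then sigma M h.choose else 1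

theorem emission_eq_sigma {i j : I} {c : M.Group ⧸ M.toCoxeterSystem.parabolic Y} (hj : j ∈ Y)
    (h : M.toCoxeterSystem.simple i * M.toCoxeterSystem.minRep c =
      M.toCoxeterSystem.minRep c * M.toCoxeterSystem.simple j) : emission i c = sigma M j := by
  have hex : ∃ j ∈ Y, M.toCoxeterSystem.simple i * M.toCoxeterSystem.minRep c =
      M.toCoxeterSystem.minRep c * M.toCoxeterSystem.simple j := ⟨j, hj, h⟩
  rw [emission, dif_pos hex]
  congr 1
  exact M.toCoxeterSystem.simple_injective
    (mul_left_cancel (hex.choose_spec.2.symm.trans h))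

theorem emission_eq_one {i : I} {c : M.Group ⧸ M.toCoxeterSystem.parabolic Y}
    (h : M.toCoxeterSystem.simple i • c ≠ c) : emission i c = 1 := by
  rw [emission, dif_neg]
  rintro ⟨j, hj, he⟩
  apply h
  rw [smul_eq_self_iff, mul_assoc, he, inv_mul_cancel_left]
  exact simple_mem_parabolic hj

theorem emission_simple_smul (i : I) (c : M.Group ⧸ M.toCoxeterSystem.parabolic Y) :
    emission i (M.toCoxeterSystem.simple i • c) = emission i c := by
  by_cases h : M.toCoxeterSystem.simple i • c = c
  · rw [h]
  · rw [emission_eq_one h, emission_eq_one]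
    rw [simple_smul_simple_smul]
    exact fun h' => h h'.symm

/-- The product of the emissions of the letters of a word acting on a coset. -/
noncomputable def wordEmission :
    List I → M.Group ⧸ M.toCoxeterSystem.parabolic Y → ArtinGroup M
  | [], _ => 1
  | i :: ω, c => emission i (M.toCoxeterSystem.wordProd ω • c) * wordEmission ω c

@[simp]
theorem wordEmission_nil (c : M.Group ⧸ M.toCoxeterSystem.parabolic Y) :
    wordEmission [] c = 1 := rfl

theorem wordEmission_cons (i : I) (ω : List I) (c : M.Group ⧸ M.toCoxeterSystem.parabolic Y) :
    wordEmission (i :: ω) c =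
      emission i (M.toCoxeterSystem.wordProd ω • c) * wordEmission ω c := rfl

theorem wordEmission_concat (ω : List I) (i : I) (c : M.Group ⧸ M.toCoxeterSystem.parabolic Y) :
    wordEmission (ω.concat i) c =
      wordEmission ω (M.toCoxeterSystem.simple i • c) * emission i c := by
  induction ω with
  | nil => simp [wordEmission_cons]
  | cons j ω ih =>
    rw [List.concat_cons, wordEmission_cons, wordEmission_cons, ih, wordProd_concat, mul_smul,
      mul_assoc]

/-- The emission of a word which extends a minimal representative to a reduced word. -/
theorem wordEmission_eq_kappa {ω : List I} {c : M.Group ⧸ M.toCoxeterSystem.parabolic Y}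
    (h : M.toCoxeterSystem.length (M.toCoxeterSystem.wordProd ω * M.toCoxeterSystem.minRep c) =
      ω.length + M.toCoxeterSystem.length (M.toCoxeterSystem.minRep c)) :
    wordEmission ω c = kappa M ((M.toCoxeterSystem.minRep (M.toCoxeterSystem.wordProd ω • c))⁻¹ *
      (M.toCoxeterSystem.wordProd ω * M.toCoxeterSystem.minRep c)) := by
  induction ω with
  | nil => simp
  | cons i ω ih =>
    rw [wordProd_cons, mul_assoc, List.length_cons] at h
    have hω : M.toCoxeterSystem.length (M.toCoxeterSystem.wordProd ω * M.toCoxeterSystem.minRep c) =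
        ω.length + M.toCoxeterSystem.length (M.toCoxeterSystem.minRep c) := by
      apply le_antisymm
      · exact (M.toCoxeterSystem.length_mul_le _ _).trans
          (Nat.add_le_add_right (M.toCoxeterSystem.length_wordProd_le ω) _)
      · have := M.toCoxeterSystem.length_mul_le (M.toCoxeterSystem.simple i)
          (M.toCoxeterSystem.wordProd ω * M.toCoxeterSystem.minRep c)
        rw [length_simple] at this
        omega
    rw [wordEmission_cons, ih hω, wordProd_cons, mul_smul]
    set c' := M.toCoxeterSystem.wordProd ω • c with hc'
    set p := (M.toCoxeterSystem.minRep c')⁻¹ *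
      (M.toCoxeterSystem.wordProd ω * M.toCoxeterSystem.minRep c) with hp
    have hrp : M.toCoxeterSystem.wordProd ω * M.toCoxeterSystem.minRep c =
        M.toCoxeterSystem.minRep c' * p := by rw [hp]; group
    have hpY : p ∈ M.toCoxeterSystem.parabolic Y := by
      rw [hp, ← QuotientGroup.eq, mk_minRep, hc']
      nth_rw 1 [← M.toCoxeterSystem.mk_minRep c]
      rfl
    -- Here `p ∈ W_Y` is the tail behind the minimal representative. A letter fixing `c'` crosses
    -- that representative and lengthens `p` by `s_j`; any other letter is absorbed by the
    -- representative and leaves `p` unchanged.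
    by_cases hi : M.toCoxeterSystem.simple i • c' = c'
    · obtain ⟨j, hj, he⟩ := exists_simple_mul_minRep hi
      have h1 := (M.toCoxeterSystem.isRightMin_minRep c').length_mul hpY
      have h2 := (M.toCoxeterSystem.isRightMin_minRep c').length_mul
        (mul_mem (simple_mem_parabolic hj) hpY)
      rw [← mul_assoc, ← he, mul_assoc, ← hrp] at h2
      rw [← hrp] at h1
      have h3 : kappa M (M.toCoxeterSystem.simple j * p) = sigma M j * kappa M p := by
        rw [kappa_mul (by rw [length_simple]; omega), kappa_simple]
      rw [emission_eq_sigma hj he, hi, mul_assoc, hrp, ← mul_assoc (M.toCoxeterSystem.simple i), he,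
        mul_assoc, inv_mul_cancel_left, h3]
    · rw [emission_eq_one hi, minRep_simple_smul hi, one_mul]
      congr 1
      rw [hp]
      group

/-- This makes the action well defined. Induction on the length of the minimal representative
reduces to the case where neither `i` nor `j` is a left descent. Both braid words then extend it
with additive length, and their emissions depend only on the common product. -/
theorem wordEmission_braidWord (i j : I) (c : M.Group ⧸ M.toCoxeterSystem.parabolic Y) :
    wordEmission (braidWord M i j) c = wordEmission (braidWord M j i) c := by
  rcases eq_or_ne i j with rfl | hij
  · rfl
  rcases Nat.eq_zero_or_pos (M i j) with h0 | hpos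
  · rw [braidWord, braidWord, h0, M.symmetric j i, h0]
    rfl
  obtain ⟨m, hm⟩ := Nat.exists_eq_succ_of_ne_zero hpos.ne'
  have step : ∀ (i j : I) (c : M.Group ⧸ M.toCoxeterSystem.parabolic Y), M i j = m + 1 →
      M.toCoxeterSystem.simple i • c ≠ c →
      wordEmission (braidWord M i j) (M.toCoxeterSystem.simple i • c) =
        wordEmission (braidWord M j i) (M.toCoxeterSystem.simple i • c) →
      wordEmission (braidWord M i j) c = wordEmission (braidWord M j i) c := by
    intro i j c hm hne ih
    have hji : M j i = m + 1 := by rw [M.symmetric, hm]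
    have hbr : M.toCoxeterSystem.wordProd (alternatingWord i j (m + 1)) =
        M.toCoxeterSystem.wordProd (alternatingWord j i (m + 1)) := by
      have := M.toCoxeterSystem.wordProd_braidWord_eq i j
      rwa [braidWord, braidWord, hm, hji] at this
    set c' := M.toCoxeterSystem.simple i • c with hc'
    have hc : M.toCoxeterSystem.simple i • c' = c := simple_smul_simple_smul i c
    have hne' : M.toCoxeterSystem.simple i • c' ≠ c' := by rw [hc]; exact hne.symm
    rw [braidWord, braidWord, hm, hji] at ih ⊢
    set l := if Even m then j else i with hl
    set q := M.toCoxeterSystem.wordProd (alternatingWord i j m) • c' with hq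
    have hql : M.toCoxeterSystem.wordProd (alternatingWord i j (m + 1)) • c' =
        M.toCoxeterSystem.simple l • q := by
      rw [alternatingWord_succ', wordProd_cons, mul_smul]
    -- By the braid relation `s_l q` is the image of `s_i c'` under the element that carries `c'` to
    -- `q`, so `s_l` moves `q` because `s_i` moves `c'`.
    have hqne : M.toCoxeterSystem.simple l • q ≠ q := by
      rw [← hql, hbr, alternatingWord_succ, wordProd_concat, mul_smul, hq]
      exact fun h => hne' (smul_left_cancel _ h)
    have hqne' : M.toCoxeterSystem.simple l • M.toCoxeterSystem.simple l • q ≠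
        M.toCoxeterSystem.simple l • q := by
      rw [simple_smul_simple_smul]
      exact hqne.symm
    -- The alternating word of length `m + 2` read from `c'` emits nothing at its two ends. Dropping
    -- one end or the other leaves the two braid words compared here, started at `c` and at `c'`.
    have e1 : wordEmission (alternatingWord i j (m + 1)) c =
        wordEmission (alternatingWord j i (m + 1)) c' := by
      have h1 := wordEmission_concat (alternatingWord i j (m + 1)) i c'
      rw [hc, emission_eq_one hne', mul_one, ← alternatingWord_succ, alternatingWord_succ',
        wordEmission_cons] at h1
      have hl' : (if Even (m + 1) then i else j) = l := by
        by_cases he : Even m <;> simp [hl, he, Nat.even_add_one]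
      rw [hl', ← hbr, hql, emission_eq_one hqne', one_mul] at h1
      exact h1.symm
    have e2 : wordEmission (alternatingWord j i (m + 1)) c =
        wordEmission (alternatingWord i j (m + 1)) c' := by
      rw [alternatingWord_succ, wordEmission_concat, emission_eq_one hne, mul_one,
        alternatingWord_succ', wordEmission_cons, emission_eq_one hqne, one_mul]
    rw [e1, e2, ih]
  induction hn : M.toCoxeterSystem.length (M.toCoxeterSystem.minRep c)
    using Nat.strong_induction_on generalizing c with
  | _ n ih =>
    have descent : ∀ k, M.toCoxeterSystem.IsLeftDescent (M.toCoxeterSystem.minRep c) k →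
        M.toCoxeterSystem.simple k • c ≠ c ∧
        wordEmission (braidWord M i j) (M.toCoxeterSystem.simple k • c) =
          wordEmission (braidWord M j i) (M.toCoxeterSystem.simple k • c) := by
      intro k hk
      have hne := mt (smul_eq_self_iff _ _).mp
        ((M.toCoxeterSystem.isRightMin_minRep c).of_simple_mul_lt hk)
      refine ⟨hne, ih _ ?_ _ rfl⟩
      rw [minRep_simple_smul hne, ← hn]
      exact hk
    by_cases hi : M.toCoxeterSystem.IsLeftDescent (M.toCoxeterSystem.minRep c) i
    · obtain ⟨h1, h2⟩ := descent i hi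
      exact step i j c hm h1 h2
    by_cases hj : M.toCoxeterSystem.IsLeftDescent (M.toCoxeterSystem.minRep c) j
    · obtain ⟨h1, h2⟩ := descent j hj
      exact (step j i c (by rw [M.symmetric, hm]) h1 h2.symm).symm
    have hmin : M.toCoxeterSystem.IsRightMin {i, j} (M.toCoxeterSystem.minRep c)⁻¹ := by
      apply IsRightMin.of_not_isRightDescent
      rintro k (rfl | rfl)
      · rwa [isRightDescent_inv_iff]
      · rwa [isRightDescent_inv_iff]
    have hmem : ∀ i' j' : I, ∀ n, (i' = i ∨ i' = j) → (j' = i ∨ j' = j) →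
        ∀ k ∈ alternatingWord i' j' n, k ∈ ({i, j} : Set I) := by
      intro i' j' n hi' hj'
      induction n generalizing i' j' with
      | zero => simp [alternatingWord]
      | succ n ihn =>
        intro k hk
        rw [alternatingWord_succ, List.concat_eq_append, List.mem_append] at hk
        rcases hk with hk | hk
        · exact ihn j' i' hj' hi' k hk
        · rw [List.mem_singleton.mp hk]; exact hj'
    have hlen : M.toCoxeterSystem.length
        (M.toCoxeterSystem.wordProd (braidWord M i j) * M.toCoxeterSystem.minRep c) =
        M i j + M.toCoxeterSystem.length (M.toCoxeterSystem.minRep c) := by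
      rw [← length_inv, mul_inv_rev, hmin.length_mul (inv_mem (wordProd_mem_parabolic
        (hmem i j _ (Or.inl rfl) (Or.inr rfl)))), length_inv, length_inv,
        (M.toCoxeterSystem.isReduced_alternatingWord hij le_rfl).eq, length_alternatingWord,
        add_comm]
    rw [wordEmission_eq_kappa (by rw [hlen, length_alternatingWord]),
      wordEmission_eq_kappa (by
        rw [← M.toCoxeterSystem.wordProd_braidWord_eq i j, hlen, length_alternatingWord,
          M.symmetric j i]),
      M.toCoxeterSystem.wordProd_braidWord_eq i j]

/-- The permutation by which the generator `σ i` acts on the product of the set of cosets of `W_Y`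
and the Artin-Tits group. -/
noncomputable def emissionPerm (Y : Set I) (i : I) :
    Equiv.Perm ((M.Group ⧸ M.toCoxeterSystem.parabolic Y) × ArtinGroup M) where
  toFun p := (M.toCoxeterSystem.simple i • p.1, emission i p.1 * p.2)
  invFun p := (M.toCoxeterSystem.simple i • p.1, (emission i p.1)⁻¹ * p.2)
  left_inv p := by
    simp only [emission_simple_smul, simple_smul_simple_smul, inv_mul_cancel_left]
  right_inv p := by
    simp only [emission_simple_smul, simple_smul_simple_smul, mul_inv_cancel_left]

theorem prod_emissionPerm_apply (ω : List I)
    (p : (M.Group ⧸ M.toCoxeterSystem.parabolic Y) × ArtinGroup M) :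
    (ω.map (emissionPerm Y)).prod p =
      (M.toCoxeterSystem.wordProd ω • p.1, wordEmission ω p.1 * p.2) := by
  induction ω with
  | nil => simp
  | cons i ω ih =>
    rw [List.map_cons, List.prod_cons, Equiv.Perm.mul_apply, ih, wordProd_cons, wordEmission_cons,
      mul_smul, mul_assoc]
    rfl

variable (M) in
/-- The action of the Artin-Tits group on the product of the set of cosets of `W_Y` and itself.
The pair `(c, a)` stands for `κ r * a`, where `r` is the minimal representative of `c`. -/
noncomputable def cosetAction (Y : Set I) :
    ArtinGroup M →* Equiv.Perm ((M.Group ⧸ M.toCoxeterSystem.parabolic Y) × ArtinGroup M) :=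
  PresentedGroup.toGroup (f := emissionPerm Y) <| by
    rintro _ ⟨⟨i, j⟩, rfl⟩
    rw [Function.uncurry, braidRelator, map_mul, map_inv, map_list_prod, map_list_prod,
      List.map_map, List.map_map, mul_inv_eq_one]
    have h : (FreeGroup.lift (emissionPerm (M := M) Y)) ∘ FreeGroup.of = emissionPerm Y := by
      funext k; simp
    rw [h]
    ext1 p
    rw [prod_emissionPerm_apply, prod_emissionPerm_apply,
      M.toCoxeterSystem.wordProd_braidWord_eq i j, wordEmission_braidWord]

theorem cosetAction_sigma (i : I) (p : (M.Group ⧸ M.toCoxeterSystem.parabolic Y) × ArtinGroup M) :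
    cosetAction M Y (sigma M i) p = (M.toCoxeterSystem.simple i • p.1, emission i p.1 * p.2) := by
  rw [cosetAction, sigma, PresentedGroup.toGroup.of]
  rfl

theorem cosetAction_wordProd (ω : List I)
    (p : (M.Group ⧸ M.toCoxeterSystem.parabolic Y) × ArtinGroup M) :
    cosetAction M Y (ω.map (sigma M)).prod p =
      (M.toCoxeterSystem.wordProd ω • p.1, wordEmission ω p.1 * p.2) := by
  rw [← prod_emissionPerm_apply, map_list_prod, List.map_map]
  congr 3

end ArtinTits

namespace ArtinTits

open CoxeterSystem

variable {I : Type*} {M : CoxeterMatrix I} {X Y : Set I} {v : M.Group}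

/-! ### Double cosets -/

theorem IsDoubleReduced.isRightMin (hv : IsDoubleReduced M X Y v) :
    M.toCoxeterSystem.IsRightMin Y v := by
  intro y hy
  have h := hv 1 (one_mem _) y hy
  rwa [one_mul] at h

theorem IsDoubleReduced.isRightMin_inv (hv : IsDoubleReduced M X Y v) :
    M.toCoxeterSystem.IsRightMin X v⁻¹ := by
  intro x hx
  have h := hv x⁻¹ (inv_mem hx) 1 (one_mem _)
  rw [mul_one] at h
  rw [length_inv, ← length_inv _ (v⁻¹ * x), mul_inv_rev, inv_inv]
  exact h

theorem IsDoubleReduced.length_mul_left (hv : IsDoubleReduced M X Y v) {x : M.Group}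
    (hx : x ∈ coxeterParabolic M X) :
    M.toCoxeterSystem.length (x * v) =
      M.toCoxeterSystem.length x + M.toCoxeterSystem.length v := by
  have h := hv.isRightMin_inv.length_mul (inv_mem hx)
  rwa [← mul_inv_rev, length_inv, length_inv, length_inv, add_comm] at h

/-- With `x = v s_j v⁻¹`, the length of `x v = v s_j` is both `ℓ(x) + ℓ(v)` and `ℓ(v) + 1`, so `x`
is a simple reflection. -/
theorem IsDoubleReduced.mem_rightSubset (hv : IsDoubleReduced M X Y v) {j : I} (hj : j ∈ Y)
    (h : v * M.toCoxeterSystem.simple j * v⁻¹ ∈ coxeterParabolic M X) :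
    j ∈ rightSubset M X Y v := by
  have h1 := hv.length_mul_left h
  rw [inv_mul_cancel_right, hv.isRightMin.length_mul_simple hj] at h1
  obtain ⟨i, hi, he⟩ := exists_simple_of_mem_parabolic (cs := M.toCoxeterSystem) h (by omega)
  exact ⟨hj, i, hi, he.symm⟩

theorem exists_mem_leftSubset {j : I} (hj : j ∈ rightSubset M X Y v) :
    ∃ i ∈ leftSubset M X Y v,
      M.toCoxeterSystem.simple i = v * M.toCoxeterSystem.simple j * v⁻¹ := by
  obtain ⟨hjY, i, hi, he⟩ := hj
  exact ⟨i, ⟨hi, j, hjY, he⟩, he⟩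

theorem exists_mem_rightSubset {i : I} (hi : i ∈ leftSubset M X Y v) :
    ∃ j ∈ rightSubset M X Y v,
      M.toCoxeterSystem.simple i = v * M.toCoxeterSystem.simple j * v⁻¹ := by
  obtain ⟨hiX, j, hj, he⟩ := hi
  exact ⟨j, ⟨hj, i, hiX, he⟩, he⟩

theorem leftSubset_subset : leftSubset M X Y v ⊆ X := fun _ h => h.1

theorem rightSubset_subset : rightSubset M X Y v ⊆ Y := fun _ h => h.1

theorem coxeterParabolic_mono {X X' : Set I} (h : X ⊆ X') :
    coxeterParabolic M X ≤ coxeterParabolic M X' :=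
  Subgroup.closure_mono (Set.image_mono h)

theorem artinParabolic_mono {X X' : Set I} (h : X ⊆ X') :
    artinParabolic M X ≤ artinParabolic M X' :=
  Subgroup.closure_mono (Set.image_mono h)

theorem conj_smul_closure_image {G : Type*} [Group G] (f : I → G) (g : G) {A B : Set I}
    (hBA : ∀ j ∈ B, ∃ i ∈ A, f i = g * f j * g⁻¹) (hAB : ∀ i ∈ A, ∃ j ∈ B, f i = g * f j * g⁻¹) :
    MulAut.conj g • Subgroup.closure (f '' B) = Subgroup.closure (f '' A) := by
  rw [Subgroup.smul_closure]
  congr 1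
  ext x
  constructor
  · rintro ⟨_, ⟨j, hj, rfl⟩, rfl⟩
    obtain ⟨i, hi, he⟩ := hBA j hj
    exact ⟨i, hi, he⟩
  · rintro ⟨i, hi, rfl⟩
    obtain ⟨j, hj, he⟩ := hAB i hi
    exact ⟨f j, ⟨j, hj, rfl⟩, he.symm⟩

variable (M X Y v) in
theorem conj_smul_coxeterParabolic_rightSubset :
    MulAut.conj v • coxeterParabolic M (rightSubset M X Y v) =
      coxeterParabolic M (leftSubset M X Y v) :=
  conj_smul_closure_image _ _ (fun _ => exists_mem_leftSubset) fun _ => exists_mem_rightSubset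

/-- Both sides of `s_i v = v s_j` are length-additive, so the relation lifts through `κ`. -/
theorem IsDoubleReduced.kappa_mul_sigma (hv : IsDoubleReduced M X Y v) {i j : I} (hi : i ∈ X)
    (hj : j ∈ Y) (h : M.toCoxeterSystem.simple i = v * M.toCoxeterSystem.simple j * v⁻¹) :
    sigma M i = kappa M v * sigma M j * (kappa M v)⁻¹ := by
  have h1 := kappa_mul (hv.length_mul_left (simple_mem_parabolic (cs := M.toCoxeterSystem) hi))
  have h2 := kappa_mul (hv.isRightMin.length_mul (simple_mem_parabolic hj))
  rw [kappa_simple] at h1 h2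
  rw [← h2, eq_mul_inv_iff_mul_eq, ← h1, h, inv_mul_cancel_right]

theorem IsDoubleReduced.conj_smul_artinParabolic_rightSubset (hv : IsDoubleReduced M X Y v) :
    MulAut.conj (kappa M v) • artinParabolic M (rightSubset M X Y v) =
      artinParabolic M (leftSubset M X Y v) := by
  apply conj_smul_closure_image
  · intro j hj
    obtain ⟨i, hi, he⟩ := exists_mem_leftSubset hj
    exact ⟨i, hi, hv.kappa_mul_sigma hi.1 hj.1 he⟩
  · intro i hi
    obtain ⟨j, hj, he⟩ := exists_mem_rightSubset hi
    exact ⟨j, hj, hv.kappa_mul_sigma hi.1 hj.1 he⟩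

/-! ### Intersections for an `(X, Y)`-reduced element -/

theorem cosetAction_of_mem_artinParabolic {α : ArtinGroup M} (hα : α ∈ artinParabolic M Y)
    (a : ArtinGroup M) :
    cosetAction M Y α (((1 : M.Group) : M.Group ⧸ M.toCoxeterSystem.parabolic Y), a) =
      (((1 : M.Group) : M.Group ⧸ M.toCoxeterSystem.parabolic Y), α * a) := by
  induction hα using Subgroup.closure_induction generalizing a with
  | mem x hx =>
    obtain ⟨j, hj, rfl⟩ := hx
    have h1 : M.toCoxeterSystem.minRep ((1 : M.Group) : M.Group ⧸ M.toCoxeterSystem.parabolic Y) =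
        1 := isRightMin_one.minRep_mk
    rw [cosetAction_sigma]
    congr 1
    · rw [smul_eq_self_iff, h1]
      simpa only [inv_one, one_mul, mul_one] using
        simple_mem_parabolic (cs := M.toCoxeterSystem) hj
    · rw [emission_eq_sigma hj (by rw [h1, one_mul, mul_one])]
  | one => simp
  | mul x y _ _ hx hy => rw [map_mul, Equiv.Perm.mul_apply, hy, hx, mul_assoc]
  | inv x _ hx => rw [map_inv, Equiv.Perm.inv_eq_iff_eq, hx, mul_inv_cancel_left]

theorem cosetAction_kappa (hv : M.toCoxeterSystem.IsRightMin Y v) (a : ArtinGroup M) :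
    cosetAction M Y (kappa M v) (((1 : M.Group) : M.Group ⧸ M.toCoxeterSystem.parabolic Y), a) =
      ((v : M.Group ⧸ M.toCoxeterSystem.parabolic Y), a) := by
  obtain ⟨ω, hω, rfl⟩ := M.toCoxeterSystem.exists_isReduced v
  have h1 : M.toCoxeterSystem.minRep ((1 : M.Group) : M.Group ⧸ M.toCoxeterSystem.parabolic Y) =
      1 := isRightMin_one.minRep_mk
  have h2 : M.toCoxeterSystem.wordProd ω •
      ((1 : M.Group) : M.Group ⧸ M.toCoxeterSystem.parabolic Y) =
        (M.toCoxeterSystem.wordProd ω : M.Group ⧸ M.toCoxeterSystem.parabolic Y) := by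
    change ((M.toCoxeterSystem.wordProd ω * 1 : M.Group) :
      M.Group ⧸ M.toCoxeterSystem.parabolic Y) = _
    rw [mul_one]
  rw [kappa_wordProd hω, cosetAction_wordProd, wordEmission_eq_kappa, h2]
  · rw [hv.minRep_mk, h1, mul_one, inv_mul_cancel, kappa_one, one_mul]
  · rw [h1, mul_one, length_one, hω.eq, add_zero]

theorem IsDoubleReduced.emission_mem (hv : IsDoubleReduced M X Y v)
    {c : M.Group ⧸ M.toCoxeterSystem.parabolic Y}
    (hc : M.toCoxeterSystem.minRep c * v⁻¹ ∈ coxeterParabolic M X) {i : I} (hi : i ∈ X) :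
    emission i c ∈ artinParabolic M (rightSubset M X Y v) := by
  by_cases h : M.toCoxeterSystem.simple i • c = c
  · obtain ⟨j, hj, he⟩ := exists_simple_mul_minRep h
    rw [emission_eq_sigma hj he]
    apply sigma_mem_artinParabolic
    apply hv.mem_rightSubset hj
    have h1 : v * M.toCoxeterSystem.simple j * v⁻¹ = (M.toCoxeterSystem.minRep c * v⁻¹)⁻¹ *
        M.toCoxeterSystem.simple i * (M.toCoxeterSystem.minRep c * v⁻¹) := by
      rw [mul_assoc _ (M.toCoxeterSystem.simple i), ← mul_assoc (M.toCoxeterSystem.simple i), he]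
      group
    rw [h1]
    exact mul_mem (mul_mem (inv_mem hc) (simple_mem_parabolic (cs := M.toCoxeterSystem) hi)) hc
  · rw [emission_eq_one h]
    exact one_mem _

theorem minRep_simple_smul_mul_mem_iff {c : M.Group ⧸ M.toCoxeterSystem.parabolic Y} {i : I}
    (hi : i ∈ X) :
    M.toCoxeterSystem.minRep (M.toCoxeterSystem.simple i • c) * v⁻¹ ∈ coxeterParabolic M X ↔
      M.toCoxeterSystem.minRep c * v⁻¹ ∈ coxeterParabolic M X := by
  by_cases h : M.toCoxeterSystem.simple i • c = c
  · rw [h]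
  · rw [minRep_simple_smul h, mul_assoc]
    exact Subgroup.mul_mem_cancel_left _ (simple_mem_parabolic (cs := M.toCoxeterSystem) hi)

/-- Stability under `A_X` of the pairs over `W_X v` with second component in `A_{Y₁}`. The
equivalence, rather than one implication, lets the induction pass through inverses. -/
theorem IsDoubleReduced.cosetAction_mem_iff (hv : IsDoubleReduced M X Y v) {β : ArtinGroup M}
    (hβ : β ∈ artinParabolic M X)
    (p : (M.Group ⧸ M.toCoxeterSystem.parabolic Y) × ArtinGroup M) :
    (M.toCoxeterSystem.minRep (cosetAction M Y β p).1 * v⁻¹ ∈ coxeterParabolic M X ∧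
      (cosetAction M Y β p).2 ∈ artinParabolic M (rightSubset M X Y v)) ↔
    (M.toCoxeterSystem.minRep p.1 * v⁻¹ ∈ coxeterParabolic M X ∧
      p.2 ∈ artinParabolic M (rightSubset M X Y v)) := by
  induction hβ using Subgroup.closure_induction generalizing p with
  | mem x hx =>
    obtain ⟨i, hi, rfl⟩ := hx
    rw [cosetAction_sigma, minRep_simple_smul_mul_mem_iff hi]
    exact and_congr_right fun h => Subgroup.mul_mem_cancel_left _ (hv.emission_mem h hi)
  | one => simp
  | mul x y _ _ hx hy => rw [map_mul, Equiv.Perm.mul_apply, hx, hy]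
  | inv x _ hx => rw [← hx, ← Equiv.Perm.mul_apply, ← map_mul, mul_inv_cancel, map_one,
      Equiv.Perm.one_apply]

theorem IsDoubleReduced.mem_artinParabolic_rightSubset (hv : IsDoubleReduced M X Y v)
    {α : ArtinGroup M} (hα : α ∈ artinParabolic M Y)
    (h : kappa M v * α * (kappa M v)⁻¹ ∈ artinParabolic M X) :
    α ∈ artinParabolic M (rightSubset M X Y v) := by
  have h1 := (hv.cosetAction_mem_iff h
    ((v : M.Group ⧸ M.toCoxeterSystem.parabolic Y), 1)).mpr
      ⟨by rw [hv.isRightMin.minRep_mk, mul_inv_cancel]; exact one_mem _, one_mem _⟩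
  -- The pair `(v, 1)` is `κ(v)` applied to `(1, 1)`; the conjugate times `κ(v)` is `κ(v) α`, which
  -- sends `(1, 1)` to `(v, α)`.
  rw [← cosetAction_kappa hv.isRightMin, ← Equiv.Perm.mul_apply, ← map_mul, inv_mul_cancel_right,
    map_mul, Equiv.Perm.mul_apply, cosetAction_of_mem_artinParabolic hα,
    cosetAction_kappa hv.isRightMin, mul_one] at h1
  exact h1.2

theorem conj_smul_inf_eq {G : Type*} [Group G] {g : G} {B C Z : Subgroup G}
    (hZ : Z ≤ B) (hC : MulAut.conj g • Z ≤ C)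
    (h : ∀ b ∈ B, g * b * g⁻¹ ∈ C → b ∈ Z) : MulAut.conj g • B ⊓ C = MulAut.conj g • Z := by
  apply le_antisymm
  · rintro _ ⟨⟨b, hb, rfl⟩, hc⟩
    exact ⟨b, h b hb hc, rfl⟩
  · exact le_inf (Subgroup.pointwise_smul_le_pointwise_smul_iff.mpr hZ) hC

theorem IsDoubleReduced.conj_artinParabolic_inf (hv : IsDoubleReduced M X Y v) :
    MulAut.conj (kappa M v) • artinParabolic M Y ⊓ artinParabolic M X =
      MulAut.conj (kappa M v) • artinParabolic M (rightSubset M X Y v) := by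
  refine conj_smul_inf_eq (artinParabolic_mono rightSubset_subset) ?_
    fun α => hv.mem_artinParabolic_rightSubset
  rw [hv.conj_smul_artinParabolic_rightSubset]
  exact artinParabolic_mono leftSubset_subset

theorem IsDoubleReduced.conj_coxeterParabolic_inf (hv : IsDoubleReduced M X Y v) :
    MulAut.conj v • coxeterParabolic M Y ⊓ coxeterParabolic M X =
      MulAut.conj v • coxeterParabolic M (rightSubset M X Y v) := by
  refine conj_smul_inf_eq (coxeterParabolic_mono rightSubset_subset) ?_ fun y hy hx => ?_
  · rw [conj_smul_coxeterParabolic_rightSubset]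
    exact coxeterParabolic_mono leftSubset_subset
  -- With `x = v y v⁻¹`, both `x v` and `v y` are length-additive, so `κ(x) κ(v) = κ(v) κ(y)`. The
  -- Artin-Tits case applies to `κ(y)`, and projection to `W` returns `y`.
  · have h1 := kappa_mul (hv.length_mul_left hx)
    rw [inv_mul_cancel_right, kappa_mul (hv.isRightMin.length_mul hy)] at h1
    have h2 := hv.mem_artinParabolic_rightSubset (kappa_mem_artinParabolic hy) (by
      rw [h1, mul_inv_cancel_right]
      exact kappa_mem_artinParabolic hx)
    simpa using toCoxeter_mem_coxeterParabolic h2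

/-! ### Intersections for an arbitrary element -/

/-- This supplies length additivity of `a v b` for `b ∈ W_Y`. A descent `j ∈ Y` of `a v` deletes a
letter of `v`, contradicting its minimality, or one of `a`. In the latter case `v s_j v⁻¹` is some
`s_i` with `i ∈ X₁`, and `a s_i` would be shorter than `a`. -/
theorem IsDoubleReduced.isRightMin_mul (hv : IsDoubleReduced M X Y v) {a : M.Group}
    (ha : a ∈ coxeterParabolic M X)
    (hmin : M.toCoxeterSystem.IsRightMin (leftSubset M X Y v) a) :
    M.toCoxeterSystem.IsRightMin Y (a * v) := by
  apply IsRightMin.of_not_isRightDescent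
  intro j hj hd
  obtain ⟨α, hα, hαX, rfl⟩ := exists_isReduced_of_mem_parabolic (cs := M.toCoxeterSystem) ha
  obtain ⟨β, hβ, rfl⟩ := M.toCoxeterSystem.exists_isReduced v
  rcases M.toCoxeterSystem.exists_eraseIdx_of_isRightDescent_mul hd with ⟨k, hk, he⟩ | ⟨k, hk, he⟩
  · have h1 : M.toCoxeterSystem.wordProd β * M.toCoxeterSystem.simple j *
        (M.toCoxeterSystem.wordProd β)⁻¹ =
          (M.toCoxeterSystem.wordProd α)⁻¹ * M.toCoxeterSystem.wordProd (α.eraseIdx k) := by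
      rw [mul_inv_eq_iff_eq_mul, mul_assoc, ← he, mul_assoc, inv_mul_cancel_left]
    have h2 := hv.mem_rightSubset hj (by
      rw [h1]
      exact mul_mem (inv_mem ha)
        (wordProd_eraseIdx_mem_parabolic (cs := M.toCoxeterSystem) hαX k))
    obtain ⟨i, hi, hie⟩ := exists_mem_leftSubset h2
    have h3 := hmin.length_mul_simple hi
    rw [hie, h1, mul_inv_cancel_left, hα.eq] at h3
    have := M.toCoxeterSystem.length_wordProd_eraseIdx_lt hk
    omega
  · have h1 := hv.isRightMin.length_mul_simple hj
    rw [he, hβ.eq] at h1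
    have := M.toCoxeterSystem.length_wordProd_eraseIdx_lt hk
    omega

theorem exists_isDecomposition (M : CoxeterMatrix I) (X Y : Set I) (w : M.Group) :
    ∃ w₁ w₂ w₂' : M.Group, IsDecomposition M X Y w w₁ w₂ w₂' := by
  obtain ⟨⟨x, y⟩, ⟨hx, hy⟩, hmin⟩ := exists_minimalFor_of_wellFoundedLT
    (fun p : M.Group × M.Group => p.1 ∈ coxeterParabolic M X ∧ p.2 ∈ coxeterParabolic M Y)
    (fun p => len M (p.1 * w * p.2)) ⟨1, one_mem _, one_mem _⟩
  refine ⟨x⁻¹, x * w * y, y⁻¹, inv_mem hx, fun x' hx' y' hy' => ?_, inv_mem hy, by group⟩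
  have h1 := hmin (j := (x' * x, y * y')) ⟨mul_mem hx' hx, mul_mem hy hy'⟩
  have h2 : x' * x * w * (y * y') = x' * (x * w * y) * y' := by group
  simp only [h2] at h1
  exact (le_total _ _).elim id h1

theorem conj_mul_mul_smul_inf {G : Type*} [Group G] {g a b : G} {B C Z : Subgroup G} (ha : a ∈ C)
    (hb : b ∈ B) (h : MulAut.conj g • B ⊓ C = MulAut.conj g • Z) :
    MulAut.conj (a * g * b) • B ⊓ C = MulAut.conj (a * g) • Z := by
  rw [map_mul, map_mul, mul_smul, mul_smul, mul_smul, ← h, Subgroup.conj_smul_eq_self_of_mem hb,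
    Subgroup.smul_inf, Subgroup.conj_smul_eq_self_of_mem ha]

theorem conj_inv_mul_mul_smul_inf {G : Type*} [Group G] {g a b : G} {B C Z : Subgroup G}
    (ha : a ∈ C) (hb : b ∈ B) (h : MulAut.conj g • B ⊓ C = MulAut.conj g • Z) :
    MulAut.conj (a * g * b)⁻¹ • C ⊓ B = MulAut.conj b⁻¹ • Z := by
  have h1 : MulAut.conj g⁻¹ • C ⊓ B = Z := by
    have := congrArg (MulAut.conj g⁻¹ • ·) h
    simpa only [Subgroup.smul_inf, smul_smul, ← map_mul, inv_mul_cancel, map_one, one_smul,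
      inf_comm] using this
  rw [← h1, Subgroup.smul_inf, Subgroup.conj_smul_eq_self_of_mem (inv_mem hb), mul_inv_rev,
    mul_inv_rev, map_mul, map_mul, mul_smul, mul_smul,
    Subgroup.conj_smul_eq_self_of_mem (inv_mem ha)]

theorem conj_mul_smul_of_mem {G : Type*} [Group G] (g : G) {h : G} {Z : Subgroup G} (hh : h ∈ Z) :
    MulAut.conj (g * h) • Z = MulAut.conj g • Z := by
  rw [map_mul, mul_smul, Subgroup.conj_smul_eq_self_of_mem hh]

/-- Every decomposition differs from a length-additive one by elements of the parabolic subgroups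
`A_{X₁}` and `A_{Y₁}`. -/
theorem IsDecomposition.exists_kappa_eq {w w₁ w₂' : M.Group}
    (h : IsDecomposition M X Y w w₁ v w₂') :
    ∃ a ∈ artinParabolic M X, ∃ b ∈ artinParabolic M Y, kappa M w = a * kappa M v * b ∧
      (∃ c ∈ artinParabolic M (leftSubset M X Y v), kappa M w₁ = a * c) ∧
      ∃ d ∈ artinParabolic M (rightSubset M X Y v), kappa M w₂' = d * b := by
  have hv := h.reduced
  obtain ⟨a, c, ha, hc, hac⟩ := M.toCoxeterSystem.exists_isRightMin_mul (leftSubset M X Y v) w₁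
  have hcX : c ∈ coxeterParabolic M X := coxeterParabolic_mono leftSubset_subset hc
  have haX : a ∈ coxeterParabolic M X := by
    rw [← mul_inv_eq_iff_eq_mul.mpr hac]
    exact mul_mem h.left_mem (inv_mem hcX)
  have hcv : v⁻¹ * c * v ∈ coxeterParabolic M (rightSubset M X Y v) := by
    rw [← coxeterParabolic_eq, ← conj_smul_coxeterParabolic_rightSubset] at hc
    simpa [Subgroup.mem_pointwise_smul_iff_inv_smul_mem] using hc
  -- The factor `c ∈ W_{X₁}` of `w₁ = a c` is carried across `v` into `W_{Y₁}`, so that `w = a v b`.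
  set b := v⁻¹ * c * v * w₂' with hb
  have hbY : b ∈ coxeterParabolic M Y :=
    mul_mem (coxeterParabolic_mono rightSubset_subset hcv) h.right_mem
  have hw : w = a * v * b := by
    rw [h.eq_mul, hac, hb]
    group
  have hκw : kappa M w = kappa M a * kappa M v * kappa M b := by
    rw [hw, kappa_mul ((hv.isRightMin_mul haX ha).length_mul hbY),
      kappa_mul (hv.length_mul_left haX)]
  have hκw₁ : kappa M w₁ = kappa M a * kappa M c := by rw [hac, kappa_mul (ha.length_mul hc)]
  -- `κ` need not be multiplicative on `b = (v⁻¹ c v) w₂'`. Instead `b` and `w₂'` are both written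
  -- as an element of `W_{Y₁}` times the same `r⁻¹`, where lengths do add.
  obtain ⟨r, z, hr, hz, hrz⟩ :=
    M.toCoxeterSystem.exists_isRightMin_mul (rightSubset M X Y v) b⁻¹
  have hκ : ∀ z' ∈ coxeterParabolic M (rightSubset M X Y v),
      kappa M (z' * r⁻¹) = kappa M z' * kappa M r⁻¹ := by
    intro z' hz'
    apply kappa_mul
    have h1 := hr.length_mul (inv_mem hz')
    rwa [← length_inv, mul_inv_rev, inv_inv, length_inv, add_comm, ← length_inv _ r] at h1
  have hbz : b = z⁻¹ * r⁻¹ := by rw [← inv_inv b, hrz, mul_inv_rev]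
  have hw₂' : w₂' = (v⁻¹ * c * v)⁻¹ * z⁻¹ * r⁻¹ := by
    rw [mul_assoc, ← hbz, hb]
    group
  have hz' := inv_mem hz
  have hd := mul_mem (inv_mem hcv) hz'
  refine ⟨kappa M a, kappa_mem_artinParabolic haX, kappa M b, kappa_mem_artinParabolic hbY, hκw,
    ⟨kappa M c, kappa_mem_artinParabolic hc, hκw₁⟩,
    kappa M ((v⁻¹ * c * v)⁻¹ * z⁻¹) * (kappa M z⁻¹)⁻¹,
    mul_mem (kappa_mem_artinParabolic hd) (inv_mem (kappa_mem_artinParabolic hz')), ?_⟩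
  rw [hw₂', hκ _ hd, hbz, hκ _ hz']
  group

end ArtinTits

/-! ### Intersections for every decomposition. -/

theorem theorem2 {I : Type*} [Finite I] (M : CoxeterMatrix I) (X Y : Set I) (w : M.Group) :
    (∃ w₁ w₂ w₂' : M.Group, ArtinTits.IsDecomposition M X Y w w₁ w₂ w₂') ∧
    ∀ w₁ w₂ w₂' : M.Group, ArtinTits.IsDecomposition M X Y w w₁ w₂ w₂' →
      ∀ X₁ Y₁ : Set I, X₁ = ArtinTits.leftSubset M X Y w₂ → Y₁ = ArtinTits.rightSubset M X Y w₂ →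
      -- the statement in the Coxeter group, for the same `w₁`, `w₂'`, `X₁`, `Y₁`
      ((MulAut.conj w • ArtinTits.coxeterParabolic M Y) ⊓ ArtinTits.coxeterParabolic M X =
          MulAut.conj (w * w₂'⁻¹) • ArtinTits.coxeterParabolic M Y₁ ∧
        (MulAut.conj w • ArtinTits.coxeterParabolic M Y) ⊓ ArtinTits.coxeterParabolic M X =
          MulAut.conj w₁ • ArtinTits.coxeterParabolic M X₁) ∧
      -- the statement in the Artin-Tits group
      ((MulAut.conj (ArtinTits.kappa M w) • ArtinTits.artinParabolic M Y) ⊓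
            ArtinTits.artinParabolic M X =
          MulAut.conj (ArtinTits.kappa M w * (ArtinTits.kappa M w₂')⁻¹) •
            ArtinTits.artinParabolic M Y₁ ∧
        (MulAut.conj (ArtinTits.kappa M w) • ArtinTits.artinParabolic M Y) ⊓
            ArtinTits.artinParabolic M X =
          MulAut.conj (ArtinTits.kappa M w₁) • ArtinTits.artinParabolic M X₁ ∧
        (MulAut.conj (ArtinTits.kappa M w)⁻¹ • ArtinTits.artinParabolic M X) ⊓
            ArtinTits.artinParabolic M Y =
          MulAut.conj (ArtinTits.kappa M w₂')⁻¹ • ArtinTits.artinParabolic M Y₁) ∧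
      -- in particular the intersection is a parabolic subgroup
      ArtinTits.IsParabolic M
        ((MulAut.conj (ArtinTits.kappa M w) • ArtinTits.artinParabolic M Y) ⊓
          ArtinTits.artinParabolic M X) := by
  refine ⟨ArtinTits.exists_isDecomposition M X Y w, ?_⟩
  rintro w₁ w₂ w₂' h X₁ Y₁ rfl rfl
  have hv := h.reduced
  obtain ⟨a, ha, b, hb, hw, ⟨c, hc, hw₁⟩, d, hd, hw₂'⟩ := h.exists_kappa_eq
  -- In `W` the given factorization can be used directly; in `A_I` only `κ(w) = a κ(w₂) b` is
  -- available, with `κ(w₁) = a c` and `κ(w₂') = d b`.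
  have hW := ArtinTits.conj_mul_mul_smul_inf h.left_mem h.right_mem hv.conj_coxeterParabolic_inf
  have hA := ArtinTits.conj_mul_mul_smul_inf ha hb hv.conj_artinParabolic_inf
  have hA' := ArtinTits.conj_inv_mul_mul_smul_inf ha hb hv.conj_artinParabolic_inf
  rw [← h.eq_mul] at hW
  rw [← hw] at hA hA'
  have hA₁ : MulAut.conj (a * ArtinTits.kappa M w₂) •
      ArtinTits.artinParabolic M (ArtinTits.rightSubset M X Y w₂) =
        MulAut.conj (ArtinTits.kappa M w₁) •
          ArtinTits.artinParabolic M (ArtinTits.leftSubset M X Y w₂) := by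
    rw [hw₁, ArtinTits.conj_mul_smul_of_mem _ hc, map_mul, mul_smul,
      hv.conj_smul_artinParabolic_rightSubset]
  refine ⟨⟨?_, ?_⟩, ⟨?_, hA.trans hA₁, ?_⟩, _, _, hA⟩
  · rw [hW, h.eq_mul, mul_inv_cancel_right]
  · rw [hW, map_mul, mul_smul, ArtinTits.conj_smul_coxeterParabolic_rightSubset]
  · rw [hA, hw, hw₂', mul_inv_rev, ← mul_assoc, mul_inv_cancel_right,
      ArtinTits.conj_mul_smul_of_mem _ (inv_mem hd)]
  · rw [hA', hw₂', mul_inv_rev, ArtinTits.conj_mul_smul_of_mem _ (inv_mem hd)]
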